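/- Let $\tilde{\mathbb R}$ be the set of reals that a deterministic Turing machine can compute to within $2^{-n}$ in time polynomial in $n$. A real-time quantum Turing machine (QTM) reads its input $w$ as $\mathrm{¢}w\$$, moving the input head one cell to the right in every step, and has one work tape and a finite register. Its transition amplitudes lie in $\tilde{\mathbb R}$, and for every input its configuration transition matrices satisfy $\sum_{\omega} E_\omega^\dagger E_\omega = I$ on the reachable configurations, $\omega$ ranging over the register symbols. After every step the register is observed to decide whether the computation continues or halts with one of the possible outcomes (for a standard machine: accept or reject), and is then reset. The machine uses $O(1)$ space if the number of work-tape cells visited with nonzero amplitude is bounded independently of the input. A language $L$ over a finite alphabet is recognized with bounded error if there is $\epsilon\in[0,\tfrac12)$ such that each $w\in L$ is accepted, and each $w\notin L$ is rejected, with probability at least $1-\epsilon$. Let $\mathrm{rtBQSPACE}(1)$ be the class of languages recognized with bounded error by real-time $O(1)$-space QTMs. Let $\mathrm{PostrtBQSPACE}(1)$ be the corresponding class for machines with postselection: the halting outcomes are postselection accept, postselection reject and nonpostselection halting; on every input $w$ the probabilities $p^a(w),p^r(w)$ of the first two satisfy $p^a(w)+p^r(w)>0$; and $w$ is accepted with probability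 $\frac{p^a(w)}{p^a(w)+p^r(w)}$ and rejected with probability $\frac{p^r(w)}{p^a(w)+p^r(w)}$. A machine with restart has the outcomes accept, reject and restart, and begins a new round from the initial configuration whenever the outcome is restart. A real-time quantum finite automaton (QFA) has a finite state set, an initial state $q_1$ and, for each symbol $\sigma$ of the input alphabet and the two end-markers, finitely many matrices $E_{\sigma,i}$ with arbitrary real entries and $\sum_i E_{\sigma,i}^\dagger E_{\sigma,i}=I$. Starting from $\rho=|q_1\rangle\langle q_1|$ it applies $\rho\mapsto\sum_i E_{\sigma,i}\,\rho\, E_{\sigma,i}^\dagger$ for each symbol of $\mathrm{¢}w\$$ and finally measures the type of the state (accept or reject; with postselection: the three outcomes above). Let $\mathrm{BQAL}$ and $\mathrm{PostBQAL}$ be the classes of languages recognized with bounded error by real-time QFAs and by real-time QFAs with postselection. **Theorem.** $$\mathrm{rtBQSPACE}(1)\subsetneq \mathrm{PostrtBQSPACE}(1)\subseteq \mathrm{PostBQAL}.$$ Moreover, the language $L_{pal}=\{w\in\{a,b\}^* : w=w^{r}\}$ of palindromes belongs to $\mathrm{PostrtBQSPACE}(1)$ and not to $\mathrm{rtBQSPACE}(1)$,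 and it is recognized with bounded error by a real-time $O(1)$-space QTM with restart; and all languages in $\mathrm{rtBQSPACE}(1)$ and all languages in $\mathrm{BQAL}$ are regular. -/

import Mathlib

open scoped Matrix

namespace Postselection

/-! # Efficiently computable real numbers -/

/-- Binary encoding of a rational number: a sign bit, the absolute value of the numerator, a
separator and the denominator. -/
def encodeRat (q : ℚ) : List (Option Bool) :=
  some (decide (q < 0)) :: ((Computability.encodeNat q.num.natAbs).map some ++
    none :: (Computability.encodeNat q.den).map some)

/-- The set `ℝ̃` of amplitudes: `p` belongs to it iff some deterministic Turing machine, given `n`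
(in unary), computes a rational number within `2⁻ⁿ` of `p` in time polynomial in `n`. -/
def EfficientlyComputable (p : ℝ) : Prop :=
  ∃ f : ℕ → ℚ,
    Nonempty (Turing.TM2ComputableInPolyTime Computability.unaryEncodeNat encodeRat f) ∧
      ∀ n : ℕ, |p - (f n : ℝ)| ≤ (1 / 2 : ℝ) ^ n

/-! # The input tape -/

/-- The symbols on the input tape: the input alphabet with the left and right end-markers. -/
inductive TapeSymbol (α : Type) : Type
  | leftEnd : TapeSymbol α
  | letter : α → TapeSymbol α
  | rightEnd : TapeSymbol α

/-- The content of the input tape: the word between the two end-markers. -/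
def inputTape {α : Type} (w : List α) : List (TapeSymbol α) :=
  TapeSymbol.leftEnd :: (w.map TapeSymbol.letter ++ [TapeSymbol.rightEnd])

/-- Moves of the work tape head. -/
inductive Move : Type
  | left : Move
  | stationary : Move
  | right : Move
  deriving DecidableEq

instance : Fintype Move where
  elems := {Move.left, Move.stationary, Move.right}
  complete := by rintro (_ | _ | _) <;> decide

/-- The displacement of the head caused by a move. -/
def Move.toInt : Move → ℤ
  | Move.left => -1
  | Move.stationary => 0
  | Move.right => 1

/-! # Real-time quantum Turing machines -/

/-- A real-time quantum Turing machine with input alphabet `α` and set of move outcomes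
`Δ = Option H`, where `none` is the outcome "continue" and the elements of `H` are the halting
outcomes. The input head moves one cell to the right in every step, so the transition amplitudes
`δ q σ γ q' γ' d ω` do not mention input head moves. Both the states and the register symbols are
partitioned according to `Δ`. -/
structure RealTimeQTM (α H : Type) where
  /-- internal states -/
  State : Type
  /-- work tape alphabet -/
  Work : Type
  /-- finite register alphabet -/
  Reg : Type
  stateFintype : Fintype State
  workFintype : Fintype Work
  regFintype : Fintype Reg
  /-- the blank symbol of the work tape -/
  blank : Work
  /-- initial state -/
  start : State
  /-- initial register symbol, to which the register is reset before every move -/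
  regStart : Reg
  /-- the partition of the states -/
  stateType : State → Option H
  /-- the partition of the register symbols -/
  regType : Reg → Option H
  /-- transition amplitudes -/
  δ : State → TapeSymbol α → Work → State → Work → Move → Reg → ℝ
  stateType_start : stateType start = none
  regType_regStart : regType regStart = none
  /-- a move out of a continuing state writes a register symbol of the type of the new state -/
  stateType_eq : ∀ q σ γ q' γ' d ω, stateType q = none → δ q σ γ q' γ' d ω ≠ 0 →
    stateType q' = regType ω

attribute [instance] RealTimeQTM.stateFintype RealTimeQTM.workFintype RealTimeQTM.regFintype

namespace RealTimeQTM

variable {α H : Type} (M : RealTimeQTM α H)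

/-- The part of a configuration that is not the input head position: internal state, work head
position and content of the (two-way infinite) work tape. In a real-time machine the input head
position equals the number of steps made. -/
structure Config where
  state : M.State
  head : ℤ
  tape : ℤ → M.Work

/-- The initial configuration. -/
def initConfig : M.Config := ⟨M.start, 0, fun _ => M.blank⟩

/-- The configuration after entering state `q'`, writing `γ'` and moving the work head by `d`. -/
def next (c : M.Config) (q' : M.State) (γ' : M.Work) (d : Move) : M.Config :=
  ⟨q', c.head + d.toInt, Function.update c.tape c.head γ'⟩

/-- The column at `c` of the configuration transition matrix `E_ω` for the input symbol `σ`. -/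
noncomputable def column (σ : TapeSymbol α) (ω : M.Reg) (c : M.Config) : M.Config →₀ ℝ :=
  ∑ q' : M.State, ∑ γ' : M.Work, ∑ d : Move,
    Finsupp.single (M.next c q' γ' d) (M.δ c.state σ (c.tape c.head) q' γ' d ω)

/-- The matrix `E_ω` for the input symbol `σ`, applied to a superposition of configurations. -/
noncomputable def evolve (σ : TapeSymbol α) (ω : M.Reg) (ψ : M.Config →₀ ℝ) : M.Config →₀ ℝ :=
  ψ.sum fun c a => a • M.column σ ω c

/-- `M.Reachable w t c`: the configuration `c` is reachable in `t` steps on input `w`. -/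
inductive Reachable (w : List α) : ℕ → M.Config → Prop
  | init : Reachable w 0 M.initConfig
  | step {t : ℕ} {c c' : M.Config} {σ : TapeSymbol α} (ω : M.Reg) :
      Reachable w t c → (inputTape w)[t]? = some σ → M.column σ ω c c' ≠ 0 →
        Reachable w (t + 1) c'

open Classical in
/-- Well-formedness, `∑_ω E_ω† E_ω = I` on the reachable configurations for every input.
(Columns belonging to different input head positions are orthogonal in a real-time machine.) -/
def WellFormed : Prop :=
  ∀ (w : List α) (t : ℕ) (σ : TapeSymbol α), (inputTape w)[t]? = some σ →
    ∀ c c' : M.Config, M.Reachable w t c → M.Reachable w t c' →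
      ∑ ω : M.Reg, ((M.column σ ω c).sum fun x a => a * M.column σ ω c' x) =
        if c = c' then 1 else 0

/-- The squared norm of an (unnormalized) superposition. -/
noncomputable def normSq {M : RealTimeQTM α H} (ψ : M.Config →₀ ℝ) : ℝ := ψ.sum fun _ a => a ^ 2

/-- The probability of halting with outcome `h` while reading the symbols of a list, from an
unnormalized superposition. After each step the register is observed; the computation goes on iff
the outcome is "continue", and the register is reset. -/
noncomputable def haltProb [DecidableEq H] (h : H) :
    List (TapeSymbol α) → (M.Config →₀ ℝ) → ℝ
  | [], _ => 0
  | σ :: s, ψ => ∑ ω : M.Reg,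
      match M.regType ω with
      | none => haltProb h s (M.evolve σ ω ψ)
      | some h' => if h' = h then normSq (M.evolve σ ω ψ) else 0

/-- The probability that `M` halts with outcome `h` on input `w`. -/
noncomputable def prob [DecidableEq H] (h : H) (w : List α) : ℝ :=
  M.haltProb h (inputTape w) (Finsupp.single M.initConfig 1)

/-- The positions of the work head that have nonzero amplitude in `ψ`. -/
def heads {M : RealTimeQTM α H} (ψ : M.Config →₀ ℝ) : Set ℤ :=
  {z | ∃ c : M.Config, ψ c ≠ 0 ∧ c.head = z}

/-- The work tape cells visited with nonzero amplitude while reading the symbols of a list, from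
an unnormalized superposition. -/
noncomputable def visitedFrom : List (TapeSymbol α) → (M.Config →₀ ℝ) → Set ℤ
  | [], ψ => heads ψ
  | σ :: s, ψ => heads ψ ∪ ⋃ ω : M.Reg,
      match M.regType ω with
      | none => visitedFrom s (M.evolve σ ω ψ)
      | some _ => heads (M.evolve σ ω ψ)

/-- The work tape cells visited with nonzero amplitude on input `w`. -/
noncomputable def visited (w : List α) : Set ℤ :=
  M.visitedFrom (inputTape w) (Finsupp.single M.initConfig 1)

/-- `M` uses `O(1)` space. -/
def ConstantSpace : Prop := ∃ K : ℕ, ∀ w : List α, (M.visited w).encard ≤ K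

/-- All transition amplitudes are in `ℝ̃`. -/
def EfficientAmplitudes : Prop :=
  ∀ q σ γ q' γ' d ω, EfficientlyComputable (M.δ q σ γ q' γ' d ω)

end RealTimeQTM

/-- A well-formed real-time QTM with efficiently computable amplitudes that uses `O(1)` space. -/
structure IsConstantSpaceQTM {α H : Type} (M : RealTimeQTM α H) : Prop where
  wellFormed : M.WellFormed
  constantSpace : M.ConstantSpace
  efficientAmplitudes : M.EfficientAmplitudes

/-! # Real-time quantum finite automata -/

/-- A real-time quantum finite automaton whose states are partitioned according to the outcomes in
`H`, observed once, at the end of the input. For every tape symbol there is a finite collection of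
operation elements with arbitrary real entries, satisfying the completeness relation. -/
structure RealTimeQFA (α H : Type) where
  State : Type
  stateFintype : Fintype State
  stateDecidableEq : DecidableEq State
  start : State
  /-- number of operation elements -/
  num : TapeSymbol α → ℕ
  /-- operation elements -/
  E : ∀ σ : TapeSymbol α, Fin (num σ) → Matrix State State ℝ
  /-- the partition of the states -/
  stateType : State → H
  complete : ∀ σ, ∑ i, (E σ i)ᴴ * E σ i = 1

attribute [instance] RealTimeQFA.stateFintype RealTimeQFA.stateDecidableEq

namespace RealTimeQFA

variable {α H : Type} (M : RealTimeQFA α H)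

/-- The superoperator of a tape symbol. -/
def superop (σ : TapeSymbol α) (ρ : Matrix M.State M.State ℝ) : Matrix M.State M.State ℝ :=
  ∑ i, M.E σ i * ρ * (M.E σ i)ᴴ

/-- The density matrix after reading a list of tape symbols. -/
def density (s : List (TapeSymbol α)) : Matrix M.State M.State ℝ :=
  s.foldl (fun ρ σ => M.superop σ ρ) (Matrix.single M.start M.start 1)

/-- The projection on the states of type `h`. -/
def proj [DecidableEq H] (h : H) : Matrix M.State M.State ℝ :=
  Matrix.diagonal fun q => if M.stateType q = h then 1 else 0

/-- The probability of observing `h` at the end of the input `w`. -/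
def prob [DecidableEq H] (h : H) (w : List α) : ℝ :=
  (M.proj h * M.density (inputTape w)).trace

end RealTimeQFA

/-! # Language recognition -/

/-- Halting outcomes of standard machines. -/
inductive Verdict : Type
  | accept : Verdict
  | reject : Verdict
  deriving DecidableEq

/-- Halting outcomes of machines with postselection: postselection accept, postselection reject,
nonpostselection halting. -/
inductive PostVerdict : Type
  | accept : PostVerdict
  | reject : PostVerdict
  | nonpost : PostVerdict
  deriving DecidableEq

/-- Outcomes that end a round of a machine with restart. -/
inductive RestartVerdict : Type
  | accept : RestartVerdict
  | reject : RestartVerdict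
  | restart : RestartVerdict
  deriving DecidableEq

/-- Bounded-error recognition of `L`, for given acceptance and rejection probabilities. -/
def BoundedError {α : Type} (accProb rejProb : List α → ℝ) (L : Language α) : Prop :=
  ∃ ε : ℝ, 0 ≤ ε ∧ ε < 1 / 2 ∧
    (∀ w, w ∈ L → 1 - ε ≤ accProb w) ∧ (∀ w, w ∉ L → 1 - ε ≤ rejProb w)

/-- Recognition of `L` with bounded error by a standard machine whose outcome probabilities are
`p`. -/
def RecognizesStd {α : Type} (p : Verdict → List α → ℝ) (L : Language α) : Prop :=
  BoundedError (p Verdict.accept) (p Verdict.reject) L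

/-- Recognition of `L` with bounded error by a machine with postselection whose outcome
probabilities before postselection are `p`: the machine is postselected with nonzero probability on
every input, and the probabilities of acceptance and rejection are normalized. -/
def RecognizesPost {α : Type} (p : PostVerdict → List α → ℝ) (L : Language α) : Prop :=
  (∀ w, 0 < p PostVerdict.accept w + p PostVerdict.reject w) ∧
    BoundedError
      (fun w => p PostVerdict.accept w / (p PostVerdict.accept w + p PostVerdict.reject w))
      (fun w => p PostVerdict.reject w / (p PostVerdict.accept w + p PostVerdict.reject w)) L

/-- Recognition of `L` with bounded error by a machine with restart whose outcome probabilities in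
a single round are `p`: the `i`-th term is the probability that the first `i` rounds end with a
restart and the next one ends with acceptance (rejection). -/
def RecognizesRestart {α : Type} (p : RestartVerdict → List α → ℝ) (L : Language α) : Prop :=
  BoundedError (fun w => ∑' i : ℕ, p RestartVerdict.restart w ^ i * p RestartVerdict.accept w)
    (fun w => ∑' i : ℕ, p RestartVerdict.restart w ^ i * p RestartVerdict.reject w) L

/-- A language over a finite alphabet. -/
structure FinLanguage where
  Alphabet : Type
  finite : Finite Alphabet
  lang : Language Alphabet

/-- The regular languages. -/
def REG : Set FinLanguage := {L | L.lang.IsRegular}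

/-- `rtBQSPACE(1)`. -/
def rtBQSPACE1 : Set FinLanguage :=
  {L | ∃ M : RealTimeQTM L.Alphabet Verdict, IsConstantSpaceQTM M ∧
    RecognizesStd (fun h w => M.prob h w) L.lang}

/-- `Post-rtBQSPACE(1)`. -/
def PostRtBQSPACE1 : Set FinLanguage :=
  {L | ∃ M : RealTimeQTM L.Alphabet PostVerdict, IsConstantSpaceQTM M ∧
    RecognizesPost (fun h w => M.prob h w) L.lang}

/-- The languages recognized with bounded error by real-time `O(1)`-space QTMs with restart. -/
def RestartRtBQSPACE1 : Set FinLanguage :=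
  {L | ∃ M : RealTimeQTM L.Alphabet RestartVerdict, IsConstantSpaceQTM M ∧
    RecognizesRestart (fun h w => M.prob h w) L.lang}

/-- The languages recognized with bounded error by real-time QFAs. -/
def BQAL : Set FinLanguage :=
  {L | ∃ M : RealTimeQFA L.Alphabet Verdict, RecognizesStd (fun h w => M.prob h w) L.lang}

/-- `PostBQAL`. -/
def PostBQAL : Set FinLanguage :=
  {L | ∃ M : RealTimeQFA L.Alphabet PostVerdict, RecognizesPost (fun h w => M.prob h w) L.lang}

/-- The language of palindromes over a two-letter alphabet. -/
def palindromes : FinLanguage where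
  Alphabet := Bool
  finite := inferInstance
  lang := {w : List Bool | w = w.reverse}

end Postselection

/-!
# Real-time constant-space quantum Turing machines with postselection

A constant-space machine can only occupy finitely many configurations with nonzero amplitude: the
visited cells form an interval around the start (`RealTimeQTM.visited_subset_Icc`), so that the
head stays in some `[-K, K]`.

*Regularity.* The acceptance probability after a common continuation `s` is a linear function of
the density matrix reached by the first part `u` of the input, up to the probability that a Turing
machine has accepted while reading `u`. The coefficients of this function
are bounded uniformly in `s`, since probabilities are at most one, and the density matrices range
over a bounded set in a finite-dimensional space. If the language is recognized with bounded
error, words with nearby density matrices are therefore equivalent in the sense of Myhill and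
Nerode, and compactness leaves finitely many classes (`isRegular_of_lipschitz`). For a quantum
finite automaton this applies directly (`BQAL_subset_REG`). For a Turing machine the well-formedness
condition bounds the coefficients only between configurations that are reachable by the same word,
so the words are moreover sorted by the finite set of bounded configurations they reach
(`RealTimeQTM.isRegular_of_isConstantSpaceQTM`).

*Postselection.* Restricted to the bounded configurations, the steps of a machine are given by
finite matrices, in general without any completeness relation. With postselection this does not
matter: the matrices are scaled down and completed by operations that lead to a nonpostselected
sink, which changes the probabilities of acceptance and rejection by the same factor
(`exists_postQFA`, `RealTimeQTM.quad_heisenberg_kraus`).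

*Palindromes.* The machine `palQTM` keeps in its amplitudes, up to a factor `4⁻ᵗ` after `t` steps,
the numbers `x` and `y` with the input and its reversal as binary expansions. At the end it accepts
with amplitude proportional to `1` and rejects with amplitude proportional to `2 * (x - y)`, which
vanishes on the palindromes and is at least `2` in absolute value on all other words. Integer
matrices are completed to multiples of isometries by further integer rows, so the amplitudes are
rational. Every computation halts, so that restarting in place of nonpostselection has the same
effect (`RecognizesPost.recognizesRestart`). The palindromes are not regular, which separates the
classes.
-/

namespace Postselection

/-! ### Finitely supported vectors -/

/-- The standard bilinear form on finitely supported real vectors. -/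
noncomputable def dot {C : Type*} : LinearMap.BilinForm ℝ (C →₀ ℝ) :=
  Finsupp.linearCombination ℝ fun x => (Finsupp.lapply x : (C →₀ ℝ) →ₗ[ℝ] ℝ)

section Dot

variable {C : Type*}

theorem dot_apply (φ ψ : C →₀ ℝ) : dot φ ψ = φ.sum fun x a => a * ψ x := by
  simp [dot, Finsupp.linearCombination_apply, Finsupp.sum, LinearMap.sum_apply]

open Classical in
theorem dot_single_single (a b : C) (x y : ℝ) :
    dot (Finsupp.single a x) (Finsupp.single b y) = if a = b then x * y else 0 := by
  rw [dot_apply, Finsupp.sum_single_index (by simp), Finsupp.single_apply]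
  by_cases h : a = b <;> simp [h, eq_comm]

theorem dot_comm (φ ψ : C →₀ ℝ) : dot φ ψ = dot ψ φ := by
  classical
  induction φ using Finsupp.induction_linear with
  | zero => simp
  | add f g hf hg => simp [hf, hg]
  | single a x =>
    induction ψ using Finsupp.induction_linear with
    | zero => simp
    | add f g hf hg => simp [hf, hg]
    | single b y =>
      rw [dot_single_single, dot_single_single]
      by_cases h : a = b
      · simp [h, mul_comm]
      · simp [h, Ne.symm h]

theorem dot_mapDomain {D : Type*} {f : C → D} (hf : Function.Injective f) (φ ψ : C →₀ ℝ) :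
    dot (φ.mapDomain f) (ψ.mapDomain f) = dot φ ψ := by
  classical
  induction φ using Finsupp.induction_linear with
  | zero => simp
  | add f g hf hg => simp [hf, hg, Finsupp.mapDomain_add]
  | single a x =>
    induction ψ using Finsupp.induction_linear with
    | zero => simp
    | add f g hf hg => rw [Finsupp.mapDomain_add, map_add, map_add, hf, hg]
    | single b y => simp [Finsupp.mapDomain_single, dot_single_single, hf.eq_iff]

theorem dot_self_nonneg (φ : C →₀ ℝ) : 0 ≤ dot φ φ := by
  rw [dot_apply]
  exact Finset.sum_nonneg fun x _ => mul_self_nonneg _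

theorem sq_le_dot_self (φ : C →₀ ℝ) (c : C) : φ c ^ 2 ≤ dot φ φ := by
  rw [dot_apply]
  by_cases h : c ∈ φ.support
  · rw [pow_two]
    exact Finset.single_le_sum (f := fun x => φ x * φ x) (fun x _ => mul_self_nonneg _) h
  · rw [Finsupp.notMem_support_iff.1 h, zero_pow two_ne_zero]
    exact Finset.sum_nonneg fun x _ => mul_self_nonneg _

end Dot

/-! ### Evolution of superpositions -/

namespace RealTimeQTM

variable {α H : Type} (M : RealTimeQTM α H)

theorem normSq_eq_dot (ψ : M.Config →₀ ℝ) : normSq ψ = dot ψ ψ := by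
  simp only [normSq, dot_apply, pow_two, Finsupp.sum]

theorem normSq_nonneg (ψ : M.Config →₀ ℝ) : 0 ≤ normSq ψ :=
  M.normSq_eq_dot ψ ▸ dot_self_nonneg ψ

@[simp]
theorem normSq_zero : normSq (0 : M.Config →₀ ℝ) = 0 := by simp [normSq]

theorem normSq_single (c : M.Config) (x : ℝ) : normSq (Finsupp.single c x) = x ^ 2 := by
  simp [normSq]

theorem evolve_eq (σ : TapeSymbol α) (ω : M.Reg) (ψ : M.Config →₀ ℝ) :
    M.evolve σ ω ψ = Finsupp.linearCombination ℝ (M.column σ ω) ψ := rfl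

@[simp]
theorem evolve_zero (σ : TapeSymbol α) (ω : M.Reg) : M.evolve σ ω 0 = 0 := by
  simp [evolve_eq]

theorem evolve_single (σ : TapeSymbol α) (ω : M.Reg) (c : M.Config) (x : ℝ) :
    M.evolve σ ω (Finsupp.single c x) = x • M.column σ ω c := by
  simp [evolve_eq]

/-- A configuration with nonzero amplitude after a step comes from one with nonzero amplitude
before it. -/
theorem exists_of_evolve_ne_zero {σ : TapeSymbol α} {ω : M.Reg} {ψ : M.Config →₀ ℝ}
    {c' : M.Config} (h : M.evolve σ ω ψ c' ≠ 0) :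
    ∃ c, ψ c ≠ 0 ∧ M.column σ ω c c' ≠ 0 := by
  by_contra! hc
  apply h
  rw [evolve, Finsupp.sum_apply]
  refine Finset.sum_eq_zero fun c hcs => ?_
  simp [hc c (Finsupp.mem_support_iff.1 hcs)]

theorem exists_of_column_ne_zero {σ : TapeSymbol α} {ω : M.Reg} {c c' : M.Config}
    (h : M.column σ ω c c' ≠ 0) :
    ∃ q' γ' d, M.δ c.state σ (c.tape c.head) q' γ' d ω ≠ 0 ∧ c' = M.next c q' γ' d := by
  by_contra! hc
  apply h
  simp only [column, Finsupp.finsetSum_apply]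
  refine Finset.sum_eq_zero fun q' _ => Finset.sum_eq_zero fun γ' _ =>
    Finset.sum_eq_zero fun d _ => ?_
  by_cases h0 : M.δ c.state σ (c.tape c.head) q' γ' d ω = 0
  · simp [h0]
  · rw [Finsupp.single_eq_of_ne (hc q' γ' d h0)]

/-- The superposition `ψ` involves only configurations that are reachable in `t` steps. -/
def IsReachable (w : List α) (t : ℕ) (ψ : M.Config →₀ ℝ) : Prop :=
  ∀ c, ψ c ≠ 0 → M.Reachable w t c

variable {M}

theorem IsReachable.single {w : List α} {t : ℕ} {c : M.Config} (hc : M.Reachable w t c) (x : ℝ) :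
    M.IsReachable w t (Finsupp.single c x) := by
  intro c' h
  by_cases h' : c = c'
  · exact h' ▸ hc
  · exact absurd (Finsupp.single_eq_of_ne (Ne.symm h')) h

theorem IsReachable.add {w : List α} {t : ℕ} {φ ψ : M.Config →₀ ℝ} (hφ : M.IsReachable w t φ)
    (hψ : M.IsReachable w t ψ) : M.IsReachable w t (φ + ψ) := by
  intro c hc
  by_cases h : φ c = 0
  · refine hψ c fun h' => hc (by simp [h, h'])
  · exact hφ c h

theorem IsReachable.neg {w : List α} {t : ℕ} {ψ : M.Config →₀ ℝ}
    (hψ : M.IsReachable w t ψ) : M.IsReachable w t (-ψ) :=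
  fun c hc => hψ c fun h' => hc (by simp [h'])

theorem IsReachable.evolve {w : List α} {t : ℕ} {ψ : M.Config →₀ ℝ} (hψ : M.IsReachable w t ψ)
    {σ : TapeSymbol α} (hσ : (inputTape w)[t]? = some σ) (ω : M.Reg) :
    M.IsReachable w (t + 1) (M.evolve σ ω ψ) := by
  intro c' hc'
  obtain ⟨c, hc, hcol⟩ := M.exists_of_evolve_ne_zero hc'
  exact Reachable.step ω (hψ c hc) hσ hcol

/-- The position of a symbol on the input tape. -/
theorem getElem?_of_eq_append {w : List α} {p s : List (TapeSymbol α)} {σ : TapeSymbol α}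
    (h : inputTape w = p ++ σ :: s) : (inputTape w)[p.length]? = some σ := by
  simp [h]

/-- On superpositions of reachable configurations a step preserves inner products. -/
theorem WellFormed.sum_dot_evolve (hM : M.WellFormed) {w : List α} {t : ℕ} {σ : TapeSymbol α}
    (hσ : (inputTape w)[t]? = some σ) {φ ψ : M.Config →₀ ℝ} (hφ : M.IsReachable w t φ)
    (hψ : M.IsReachable w t ψ) :
    ∑ ω, dot (M.evolve σ ω φ) (M.evolve σ ω ψ) = dot φ ψ := by
  classical
  have key : ∀ c ∈ φ.support, ∀ c' ∈ ψ.support,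
      ∑ ω, dot (M.column σ ω c) (M.column σ ω c') = if c = c' then 1 else 0 := by
    intro c hc c' hc'
    simp only [dot_apply]
    convert hM w t σ hσ c c' (hφ c (Finsupp.mem_support_iff.1 hc))
      (hψ c' (Finsupp.mem_support_iff.1 hc'))
  have h1 : ∀ ω, dot (M.evolve σ ω φ) (M.evolve σ ω ψ) = ∑ c ∈ φ.support, ∑ c' ∈ ψ.support,
      φ c * ψ c' * dot (M.column σ ω c) (M.column σ ω c') := by
    intro ω
    simp only [RealTimeQTM.evolve, Finsupp.sum, map_sum, LinearMap.sum_apply, map_smul,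
      LinearMap.smul_apply, smul_eq_mul]
    rw [Finset.sum_comm]
    refine Finset.sum_congr rfl fun c _ => ?_
    rw [Finset.mul_sum]
    refine Finset.sum_congr rfl fun c' _ => by ring
  simp only [h1]
  rw [Finset.sum_comm, dot_apply]
  refine Finset.sum_congr rfl fun c hc => ?_
  rw [Finset.sum_comm]
  have h2 : ∀ c' ∈ ψ.support,
      ∑ ω, φ c * ψ c' * dot (M.column σ ω c) (M.column σ ω c') =
        if c = c' then φ c * ψ c' else 0 := by
    intro c' hc'
    rw [← Finset.mul_sum, key c hc c' hc']
    simp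
  rw [Finset.sum_congr rfl h2, Finset.sum_ite_eq]
  by_cases h : c ∈ ψ.support
  · simp [h]
  · simp [h, Finsupp.notMem_support_iff.1 h]

theorem WellFormed.sum_normSq_evolve (hM : M.WellFormed) {w : List α} {t : ℕ} {σ : TapeSymbol α}
    (hσ : (inputTape w)[t]? = some σ) {ψ : M.Config →₀ ℝ} (hψ : M.IsReachable w t ψ) :
    ∑ ω, normSq (M.evolve σ ω ψ) = normSq ψ := by
  simp only [normSq_eq_dot]
  exact hM.sum_dot_evolve hσ hψ hψ

/-! ### Halting probabilities -/

variable (M)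

/-- The sum of `g` over the (unnormalized) superpositions in which the computation continues after
reading the symbols of a list, starting from a superposition. -/
noncomputable def contSum (g : (M.Config →₀ ℝ) → ℝ) :
    List (TapeSymbol α) → (M.Config →₀ ℝ) → ℝ
  | [], ψ => g ψ
  | σ :: s, ψ => ∑ ω : M.Reg,
      match M.regType ω with
      | none => contSum g s (M.evolve σ ω ψ)
      | some _ => 0

theorem contSum_nonneg {g : (M.Config →₀ ℝ) → ℝ} (hg : ∀ ψ, 0 ≤ g ψ)
    (s : List (TapeSymbol α)) (ψ : M.Config →₀ ℝ) : 0 ≤ M.contSum g s ψ := by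
  induction s generalizing ψ with
  | nil => exact hg ψ
  | cons σ s ih =>
    simp only [contSum]
    refine Finset.sum_nonneg fun ω _ => ?_
    cases M.regType ω with
    | none => exact ih _
    | some h' => exact le_rfl

theorem abs_contSum_le {f g : (M.Config →₀ ℝ) → ℝ} (hfg : ∀ ψ, |f ψ| ≤ g ψ)
    (s : List (TapeSymbol α)) (ψ : M.Config →₀ ℝ) : |M.contSum f s ψ| ≤ M.contSum g s ψ := by
  induction s generalizing ψ with
  | nil => exact hfg ψ
  | cons σ s ih =>
    simp only [contSum]
    refine (Finset.abs_sum_le_sum_abs _ _).trans (Finset.sum_le_sum fun ω _ => ?_)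
    cases M.regType ω with
    | none => exact ih _
    | some h' => simp

theorem contSum_sum_mul {ι : Type*} (I : Finset ι) (a : ι → ℝ) (g : ι → (M.Config →₀ ℝ) → ℝ)
    (s : List (TapeSymbol α)) (ψ : M.Config →₀ ℝ) :
    M.contSum (fun φ => ∑ i ∈ I, a i * g i φ) s ψ = ∑ i ∈ I, a i * M.contSum (g i) s ψ := by
  induction s generalizing ψ with
  | nil => rfl
  | cons σ s ih =>
    simp only [contSum, Finset.mul_sum]
    rw [Finset.sum_comm]
    refine Finset.sum_congr rfl fun ω _ => ?_
    cases M.regType ω with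
    | none => exact ih _
    | some h' => simp

variable [DecidableEq H]

theorem haltProb_append (h : H) (s r : List (TapeSymbol α)) (ψ : M.Config →₀ ℝ) :
    M.haltProb h (s ++ r) ψ = M.haltProb h s ψ + M.contSum (M.haltProb h r) s ψ := by
  induction s generalizing ψ with
  | nil => simp [haltProb, contSum]
  | cons σ s ih =>
    simp only [List.cons_append, haltProb, contSum, ← Finset.sum_add_distrib]
    refine Finset.sum_congr rfl fun ω _ => ?_
    cases M.regType ω <;> simp [ih]

theorem haltProb_nonneg (h : H) (s : List (TapeSymbol α)) (ψ : M.Config →₀ ℝ) :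
    0 ≤ M.haltProb h s ψ := by
  induction s generalizing ψ with
  | nil => simp [haltProb]
  | cons σ s ih =>
    simp only [haltProb]
    refine Finset.sum_nonneg fun ω _ => ?_
    cases M.regType ω with
    | none => exact ih _
    | some h' =>
      dsimp only
      split_ifs
      exacts [M.normSq_nonneg _, le_rfl]

variable {M}

/-- Conservation of probability: the halting probabilities and the weight with which the
computation continues add up to the initial weight. -/
theorem WellFormed.sum_haltProb_add [Fintype H] (hM : M.WellFormed) {w : List α}
    {p s r : List (TapeSymbol α)} (hw : inputTape w = p ++ s ++ r) {ψ : M.Config →₀ ℝ}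
    (hψ : M.IsReachable w p.length ψ) :
    ∑ h, M.haltProb h s ψ + M.contSum normSq s ψ = normSq ψ := by
  induction s generalizing p ψ with
  | nil => simp [haltProb, contSum]
  | cons σ s ih =>
    have hσ : (inputTape w)[p.length]? = some σ :=
      getElem?_of_eq_append (s := s ++ r) (by simpa using hw)
    rw [← hM.sum_normSq_evolve hσ hψ]
    simp only [haltProb, contSum]
    rw [Finset.sum_comm, ← Finset.sum_add_distrib]
    refine Finset.sum_congr rfl fun ω _ => ?_
    have := ih (p := p ++ [σ]) (ψ := M.evolve σ ω ψ) (by simpa using hw)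
      (by simpa using hψ.evolve hσ ω)
    cases M.regType ω with
    | none => exact this
    | some h' => simp

theorem WellFormed.sum_prob_add [Fintype H] (hM : M.WellFormed) (w : List α) :
    ∑ h, M.prob h w + M.contSum normSq (inputTape w) (Finsupp.single M.initConfig 1) = 1 := by
  have := hM.sum_haltProb_add (w := w) (p := []) (s := inputTape w) (r := []) (by simp)
    (IsReachable.single Reachable.init 1)
  rw [normSq_single, one_pow] at this
  exact this

theorem WellFormed.sum_prob_le [Fintype H] (hM : M.WellFormed) (w : List α) :
    ∑ h, M.prob h w ≤ 1 := by
  rw [← hM.sum_prob_add w]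
  linarith [M.contSum_nonneg M.normSq_nonneg (inputTape w) (Finsupp.single M.initConfig 1)]

theorem WellFormed.haltProb_le [Fintype H] (hM : M.WellFormed) {w : List α}
    {p s r : List (TapeSymbol α)} (hw : inputTape w = p ++ s ++ r) {ψ : M.Config →₀ ℝ}
    (hψ : M.IsReachable w p.length ψ) (h : H) : M.haltProb h s ψ ≤ normSq ψ := by
  rw [← hM.sum_haltProb_add hw hψ]
  have := Finset.single_le_sum (f := fun h => M.haltProb h s ψ)
    (fun h _ => M.haltProb_nonneg h s ψ) (Finset.mem_univ h)
  have := M.contSum_nonneg M.normSq_nonneg s ψ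
  linarith

theorem WellFormed.contSum_normSq_le [Fintype H] (hM : M.WellFormed) {w : List α}
    {p s r : List (TapeSymbol α)} (hw : inputTape w = p ++ s ++ r) {ψ : M.Config →₀ ℝ}
    (hψ : M.IsReachable w p.length ψ) : M.contSum normSq s ψ ≤ normSq ψ := by
  rw [← hM.sum_haltProb_add hw hψ]
  have := Finset.sum_nonneg (s := Finset.univ) (fun h _ => M.haltProb_nonneg h s ψ)
  linarith

variable (M)

/-- The probability of halting with a given outcome is a quadratic form in the superposition. -/
theorem exists_bilinForm_haltProb (h : H) (s : List (TapeSymbol α)) :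
    ∃ B : LinearMap.BilinForm ℝ (M.Config →₀ ℝ), (∀ φ ψ, B φ ψ = B ψ φ) ∧
      ∀ ψ, M.haltProb h s ψ = B ψ ψ := by
  induction s with
  | nil => exact ⟨0, by simp, by simp [haltProb]⟩
  | cons σ s ih =>
    obtain ⟨B, hB, hs⟩ := ih
    let T (ω : M.Reg) : (M.Config →₀ ℝ) →ₗ[ℝ] (M.Config →₀ ℝ) :=
      Finsupp.linearCombination ℝ (M.column σ ω)
    let D (ω : M.Reg) : LinearMap.BilinForm ℝ (M.Config →₀ ℝ) :=
      match M.regType ω with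
      | none => B
      | some h' => if h' = h then dot else 0
    have hD : ∀ ω φ ψ, D ω φ ψ = D ω ψ φ := by
      intro ω φ ψ
      simp only [D]
      cases M.regType ω with
      | none => exact hB φ ψ
      | some h' =>
        dsimp only
        split_ifs
        exacts [dot_comm φ ψ, rfl]
    refine ⟨∑ ω, (D ω).compl₁₂ (T ω) (T ω), fun φ ψ => ?_, fun ψ => ?_⟩
    · simp only [LinearMap.sum_apply, LinearMap.compl₁₂_apply]
      exact Finset.sum_congr rfl fun ω _ => hD ω _ _
    · simp only [LinearMap.sum_apply, LinearMap.compl₁₂_apply, haltProb]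
      refine Finset.sum_congr rfl fun ω _ => ?_
      simp only [D, T, ← evolve_eq]
      cases M.regType ω with
      | none => exact hs _
      | some h' =>
        dsimp only
        split_ifs
        exacts [M.normSq_eq_dot _, rfl]

end RealTimeQTM

/-! ### Renaming the halting outcomes -/

namespace RealTimeQTM

variable {α H H' : Type} (M : RealTimeQTM α H) (f : H → H')

/-- The machine `M` with its halting outcomes renamed by `f`. -/
abbrev relabel : RealTimeQTM α H' where
  State := M.State
  Work := M.Work
  Reg := M.Reg
  stateFintype := M.stateFintype
  workFintype := M.workFintype
  regFintype := M.regFintype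
  blank := M.blank
  start := M.start
  regStart := M.regStart
  stateType q := (M.stateType q).map f
  regType ω := (M.regType ω).map f
  δ := M.δ
  stateType_start := by simp [M.stateType_start]
  regType_regStart := by simp [M.regType_regStart]
  stateType_eq q σ γ q' γ' d ω hq hδ := by
    rw [M.stateType_eq q σ γ q' γ' d ω (by simpa using hq) hδ]

/-- A configuration of `M` as a configuration of the relabelled machine. -/
def relabelConfig (c : M.Config) : (M.relabel f).Config := ⟨c.state, c.head, c.tape⟩

theorem relabelConfig_injective : Function.Injective (M.relabelConfig f) := by
  rintro ⟨q, z, t⟩ ⟨q', z', t'⟩ h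
  simp only [relabelConfig] at h
  obtain ⟨rfl, rfl, rfl⟩ := h
  rfl

theorem column_relabel (σ : TapeSymbol α) (ω : M.Reg) (c : M.Config) :
    (M.relabel f).column σ ω (M.relabelConfig f c) =
      (M.column σ ω c).mapDomain (M.relabelConfig f) := by
  simp only [column, Finsupp.mapDomain_finsetSum, Finsupp.mapDomain_single]
  rfl

theorem evolve_relabel (σ : TapeSymbol α) (ω : M.Reg) (ψ : M.Config →₀ ℝ) :
    (M.relabel f).evolve σ ω (ψ.mapDomain (M.relabelConfig f)) =
      (M.evolve σ ω ψ).mapDomain (M.relabelConfig f) := by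
  induction ψ using Finsupp.induction_linear with
  | zero => simp
  | add φ ψ hφ hψ =>
    rw [evolve_eq] at hφ hψ ⊢
    rw [Finsupp.mapDomain_add, map_add, hφ, hψ, evolve_eq, evolve_eq, evolve_eq, map_add,
      Finsupp.mapDomain_add]
  | single c x =>
    rw [Finsupp.mapDomain_single, evolve_single, evolve_single, column_relabel,
      Finsupp.mapDomain_smul]

theorem normSq_relabel (ψ : M.Config →₀ ℝ) :
    normSq (ψ.mapDomain (M.relabelConfig f)) = normSq ψ := by
  rw [normSq_eq_dot, normSq_eq_dot, dot_mapDomain (M.relabelConfig_injective f)]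

theorem heads_relabel (ψ : M.Config →₀ ℝ) :
    heads (ψ.mapDomain (M.relabelConfig f)) = heads ψ := by
  ext z
  constructor
  · rintro ⟨⟨q, z', t⟩, hc, rfl⟩
    refine ⟨⟨q, z', t⟩, ?_, rfl⟩
    rwa [← Finsupp.mapDomain_apply (M.relabelConfig_injective f)]
  · rintro ⟨c, hc, rfl⟩
    refine ⟨M.relabelConfig f c, ?_, rfl⟩
    rwa [Finsupp.mapDomain_apply (M.relabelConfig_injective f)]

theorem haltProb_relabel [DecidableEq H] [DecidableEq H'] (hf : Function.Injective f) (h : H)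
    (s : List (TapeSymbol α)) (ψ : M.Config →₀ ℝ) :
    (M.relabel f).haltProb (f h) s (ψ.mapDomain (M.relabelConfig f)) = M.haltProb h s ψ := by
  induction s generalizing ψ with
  | nil => rfl
  | cons σ s ih =>
    simp only [haltProb]
    refine Finset.sum_congr rfl fun (ω : M.Reg) _ => ?_
    rw [evolve_relabel]
    simp only [relabel]
    cases M.regType ω with
    | none => exact ih _
    | some h' => simp only [Option.map_some, hf.eq_iff]; rw [← M.normSq_relabel f]

theorem visitedFrom_relabel (s : List (TapeSymbol α)) (ψ : M.Config →₀ ℝ) :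
    (M.relabel f).visitedFrom s (ψ.mapDomain (M.relabelConfig f)) = M.visitedFrom s ψ := by
  induction s generalizing ψ with
  | nil => exact M.heads_relabel f ψ
  | cons σ s ih =>
    simp only [visitedFrom]
    congr 1
    · exact M.heads_relabel f ψ
    · refine Set.iUnion_congr fun (ω : M.Reg) => ?_
      rw [evolve_relabel]
      simp only [relabel]
      cases M.regType ω with
      | none => exact ih _
      | some h' => exact M.heads_relabel f _

theorem initConfig_relabel : (M.relabel f).initConfig = M.relabelConfig f M.initConfig := rfl

theorem prob_relabel [DecidableEq H] [DecidableEq H'] (hf : Function.Injective f) (h : H)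
    (w : List α) : (M.relabel f).prob (f h) w = M.prob h w := by
  rw [prob, prob, initConfig_relabel, ← M.haltProb_relabel f hf, Finsupp.mapDomain_single]

theorem Reachable.of_relabel {w : List α} {t : ℕ} {c : (M.relabel f).Config}
    (hc : (M.relabel f).Reachable w t c) : ∃ c', M.Reachable w t c' ∧ c = M.relabelConfig f c' := by
  induction hc with
  | init => exact ⟨_, Reachable.init, rfl⟩
  | @step t c c' σ ω _ hσ hcol ih =>
    obtain ⟨c₀, hc₀, rfl⟩ := ih
    refine ⟨⟨c'.state, c'.head, c'.tape⟩, Reachable.step ω hc₀ hσ ?_, rfl⟩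
    rw [column_relabel] at hcol
    rw [← Finsupp.mapDomain_apply (M.relabelConfig_injective f)]
    exact hcol

theorem isConstantSpaceQTM_relabel (hM : IsConstantSpaceQTM M) :
    IsConstantSpaceQTM (M.relabel f) where
  wellFormed := by
    classical
    intro w t σ hσ c c' hc hc'
    obtain ⟨c, h₁, rfl⟩ := Reachable.of_relabel M f hc
    obtain ⟨c', h₂, rfl⟩ := Reachable.of_relabel M f hc'
    rw [if_congr (M.relabelConfig_injective f).eq_iff rfl rfl]
    refine Eq.trans ?_ (hM.wellFormed w t σ hσ c c' h₁ h₂)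
    refine Finset.sum_congr rfl fun (ω : M.Reg) _ => ?_
    rw [← dot_apply, ← dot_apply, column_relabel, column_relabel,
      dot_mapDomain (M.relabelConfig_injective f)]
  constantSpace := by
    obtain ⟨K, hK⟩ := hM.constantSpace
    refine ⟨K, fun w => ?_⟩
    rw [visited, initConfig_relabel, ← Finsupp.mapDomain_single, visitedFrom_relabel]
    exact hK w
  efficientAmplitudes := hM.efficientAmplitudes

end RealTimeQTM

/-! ### Standard machines, postselection and restart -/

instance : Fintype Verdict where
  elems := {Verdict.accept, Verdict.reject}
  complete := by rintro (_ | _) <;> decide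

instance : Fintype PostVerdict where
  elems := {PostVerdict.accept, PostVerdict.reject, PostVerdict.nonpost}
  complete := by rintro (_ | _ | _) <;> decide

theorem sum_verdict (p : Verdict → ℝ) : ∑ h, p h = p .accept + p .reject := by
  simp [Finset.univ, Fintype.elems]

theorem sum_postVerdict (p : PostVerdict → ℝ) :
    ∑ h, p h = p .accept + (p .reject + p .nonpost) := by
  simp [Finset.univ, Fintype.elems]

/-- The outcomes of a standard machine as outcomes of a machine with postselection. -/
def Verdict.toPost : Verdict → PostVerdict
  | .accept => .accept
  | .reject => .reject

theorem Verdict.toPost_injective : Function.Injective Verdict.toPost := by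
  rintro (_ | _) (_ | _) h <;> first | rfl | cases h

/-- Nonpostselection halting is turned into restart. -/
def PostVerdict.toRestart : PostVerdict → RestartVerdict
  | .accept => .accept
  | .reject => .reject
  | .nonpost => .restart

theorem PostVerdict.toRestart_injective : Function.Injective PostVerdict.toRestart := by
  rintro (_ | _ | _) (_ | _ | _) h <;> first | rfl | cases h

/-- Bounded error forces the outcome probabilities to be positive somewhere, and normalizing
subprobabilities can only increase them. -/
theorem RecognizesStd.recognizesPost {α : Type} {p : Verdict → List α → ℝ}
    {q : PostVerdict → List α → ℝ} {L : Language α} (h : RecognizesStd p L)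
    (hp0 : ∀ v w, 0 ≤ p v w) (hp1 : ∀ w, p .accept w + p .reject w ≤ 1)
    (ha : ∀ w, q .accept w = p .accept w) (hr : ∀ w, q .reject w = p .reject w) :
    RecognizesPost q L := by
  obtain ⟨ε, hε0, hε, hacc, hrej⟩ := h
  have hpos : ∀ w, 0 < p .accept w + p .reject w := by
    intro w
    have h1 := hp0 .accept w
    have h2 := hp0 .reject w
    by_cases hw : w ∈ L
    · linarith [hacc w hw]
    · linarith [hrej w hw]
  refine ⟨fun w => by rw [ha, hr]; exact hpos w, ε, hε0, hε, fun w hw => ?_, fun w hw => ?_⟩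
  · simp only [ha, hr]
    exact (hacc w hw).trans (le_div_self (hp0 _ w) (hpos w) (hp1 w))
  · simp only [ha, hr]
    exact (hrej w hw).trans (le_div_self (hp0 _ w) (hpos w) (hp1 w))

/-- If the three outcomes exhaust all possibilities, restarting on nonpostselection amounts to
postselection: the geometric series normalizes the probabilities. -/
theorem RecognizesPost.recognizesRestart {α : Type} {p : PostVerdict → List α → ℝ}
    {q : RestartVerdict → List α → ℝ} {L : Language α} (h : RecognizesPost p L)
    (hp0 : ∀ v w, 0 ≤ p v w) (hp1 : ∀ w, ∑ v, p v w = 1)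
    (hq : ∀ v w, q (PostVerdict.toRestart v) w = p v w) : RecognizesRestart q L := by
  have hq_a : ∀ w, q .accept w = p .accept w := hq .accept
  have hq_r : ∀ w, q .reject w = p .reject w := hq .reject
  have hq_n : ∀ w, q .restart w = p .nonpost w := hq .nonpost
  have key : ∀ w x, ∑' i : ℕ, q .restart w ^ i * x =
      x / (p .accept w + p .reject w) := by
    intro w x
    have h1 := hp1 w
    rw [sum_postVerdict] at h1
    have h2 := h.1 w
    have h3 : 1 - q .restart w = p .accept w + p .reject w := by rw [hq_n]; linarith
    rw [tsum_mul_right, tsum_geometric_of_lt_one (by rw [hq_n]; exact hp0 _ w) (by linarith), h3,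
      div_eq_inv_mul]
  unfold RecognizesRestart
  simp only [key, hq_a, hq_r]
  exact h.2

theorem rtBQSPACE1_subset_postRtBQSPACE1 : rtBQSPACE1 ⊆ PostRtBQSPACE1 := by
  rintro L ⟨M, hM, hL⟩
  refine ⟨M.relabel Verdict.toPost, M.isConstantSpaceQTM_relabel _ hM,
    hL.recognizesPost (fun v w => M.haltProb_nonneg v _ _) (fun w => ?_)
      (fun w => M.prob_relabel _ Verdict.toPost_injective .accept w)
      (fun w => M.prob_relabel _ Verdict.toPost_injective .reject w)⟩
  rw [← sum_verdict fun v => M.prob v w]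
  exact hM.wellFormed.sum_prob_le w

/-! ### Computations in bounded space -/

namespace RealTimeQTM

variable {α H : Type} (M : RealTimeQTM α H)

theorem heads_subset_visitedFrom (s : List (TapeSymbol α)) (ψ : M.Config →₀ ℝ) :
    heads ψ ⊆ M.visitedFrom s ψ := by
  cases s with
  | nil => exact subset_rfl
  | cons σ s => exact Set.subset_union_left

theorem visitedFrom_evolve_subset {σ : TapeSymbol α} {ω : M.Reg} (hω : M.regType ω = none)
    (s : List (TapeSymbol α)) (ψ : M.Config →₀ ℝ) :
    M.visitedFrom s (M.evolve σ ω ψ) ⊆ M.visitedFrom (σ :: s) ψ := by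
  intro z hz
  simp only [visitedFrom]
  refine Or.inr (Set.mem_iUnion.2 ⟨ω, ?_⟩)
  simpa only [hω] using hz

theorem heads_evolve_subset (σ : TapeSymbol α) (ω : M.Reg) (s : List (TapeSymbol α))
    (ψ : M.Config →₀ ℝ) : heads (M.evolve σ ω ψ) ⊆ M.visitedFrom (σ :: s) ψ := by
  cases hω : M.regType ω with
  | none => exact (M.heads_subset_visitedFrom s _).trans (M.visitedFrom_evolve_subset hω s ψ)
  | some h =>
    intro z hz
    simp only [visitedFrom]
    refine Or.inr (Set.mem_iUnion.2 ⟨ω, ?_⟩)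
    simpa only [hω] using hz

/-- The work head moves by at most one cell per step. -/
theorem exists_heads_of_evolve {σ : TapeSymbol α} {ω : M.Reg} {ψ : M.Config →₀ ℝ} {z : ℤ}
    (hz : z ∈ heads (M.evolve σ ω ψ)) : ∃ z₀ ∈ heads ψ, |z - z₀| ≤ 1 := by
  obtain ⟨c', hc', rfl⟩ := hz
  obtain ⟨c, hc, hcol⟩ := M.exists_of_evolve_ne_zero hc'
  obtain ⟨q', γ', d, -, rfl⟩ := M.exists_of_column_ne_zero hcol
  refine ⟨c.head, ⟨c, hc, rfl⟩, ?_⟩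
  cases d <;> simp [next, Move.toInt]

/-- The visited cells are connected to the initial position of the work head. -/
theorem exists_uIcc_subset_visitedFrom (s : List (TapeSymbol α)) (ψ : M.Config →₀ ℝ) {z : ℤ}
    (hz : z ∈ M.visitedFrom s ψ) : ∃ z₀ ∈ heads ψ, Set.uIcc z₀ z ⊆ M.visitedFrom s ψ := by
  have self : ∀ {s} {ψ : M.Config →₀ ℝ} {z}, z ∈ heads ψ →
      ∃ z₀ ∈ heads ψ, Set.uIcc z₀ z ⊆ M.visitedFrom s ψ := by
    intro s ψ z hz
    refine ⟨z, hz, ?_⟩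
    rw [Set.uIcc_self, Set.singleton_subset_iff]
    exact M.heads_subset_visitedFrom s ψ hz
  have step : ∀ {σ ω} {ψ : M.Config →₀ ℝ} {z z₁ : ℤ} {S : Set ℤ}, heads ψ ⊆ S →
      z₁ ∈ heads (M.evolve σ ω ψ) → Set.uIcc z₁ z ⊆ S →
        ∃ z₀ ∈ heads ψ, Set.uIcc z₀ z ⊆ S := by
    intro σ ω ψ z z₁ S hS hz₁ hz
    obtain ⟨z₀, hz₀, hd⟩ := M.exists_heads_of_evolve hz₁
    refine ⟨z₀, hz₀, fun x hx => ?_⟩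
    by_cases hxz : x = z₀
    · exact hxz ▸ hS hz₀
    · apply hz
      rw [Set.mem_uIcc] at hx ⊢
      rw [abs_le] at hd
      omega
  induction s generalizing ψ with
  | nil => exact self hz
  | cons σ s ih =>
    have hz' := hz
    simp only [visitedFrom] at hz'
    rcases hz' with hz' | hz'
    · exact self hz'
    · obtain ⟨ω, hω⟩ := Set.mem_iUnion.1 hz'
      have hψ := M.heads_subset_visitedFrom (σ :: s) ψ
      cases hr : M.regType ω with
      | none =>
        simp only [hr] at hω
        obtain ⟨z₁, hz₁, hsub⟩ := ih _ hω
        exact step hψ hz₁ (hsub.trans (M.visitedFrom_evolve_subset hr s ψ))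
      | some h =>
        simp only [hr] at hω
        refine step hψ hω ?_
        rw [Set.uIcc_self, Set.singleton_subset_iff]
        exact M.heads_evolve_subset σ ω s ψ hω

theorem visitedFrom_subset_heads
    (hM : ∀ σ ω (ψ : M.Config →₀ ℝ), heads (M.evolve σ ω ψ) ⊆ heads ψ)
    (s : List (TapeSymbol α)) (ψ : M.Config →₀ ℝ) : M.visitedFrom s ψ ⊆ heads ψ := by
  induction s generalizing ψ with
  | nil => exact subset_rfl
  | cons σ s ih =>
    simp only [visitedFrom]
    refine Set.union_subset subset_rfl (Set.iUnion_subset fun ω => ?_)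
    cases M.regType ω with
    | none => exact (ih _).trans (hM σ ω ψ)
    | some h => exact hM σ ω ψ

theorem visited_subset_Icc {K : ℕ} {w : List α} (hK : (M.visited w).encard ≤ K) :
    M.visited w ⊆ Set.Icc (-K : ℤ) K := by
  intro z hz
  obtain ⟨z₀, ⟨c, hc, rfl⟩, hsub⟩ := M.exists_uIcc_subset_visitedFrom _ _ hz
  have hc0 : c = M.initConfig := by
    by_contra h
    exact hc (Finsupp.single_eq_of_ne h)
  have h0 : c.head = 0 := by rw [hc0]; rfl
  rw [h0] at hsub
  have h1 := (Set.encard_le_encard hsub).trans hK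
  rw [← Finset.coe_uIcc, Set.encard_coe_eq_coe_finsetCard, Int.card_uIcc] at h1
  have h2 : (z - 0).natAbs + 1 ≤ K := by exact_mod_cast h1
  rw [Set.mem_Icc]
  omega

/-- The configurations with head position and nonblank cells in `[-K, K]`. -/
def boundedConfigs (K : ℕ) : Set M.Config :=
  {c | c.head ∈ Set.Icc (-K : ℤ) K ∧ ∀ z ∉ Set.Icc (-K : ℤ) K, c.tape z = M.blank}

theorem finite_boundedConfigs (K : ℕ) : (M.boundedConfigs K).Finite := by
  let f : M.boundedConfigs K → M.State × Set.Icc (-K : ℤ) K × (Set.Icc (-K : ℤ) K → M.Work) :=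
    fun c => (c.1.state, ⟨c.1.head, c.2.1⟩, fun z => c.1.tape z)
  have hf : Function.Injective f := by
    rintro ⟨⟨q, z, t⟩, hz, ht⟩ ⟨⟨q', z', t'⟩, hz', ht'⟩ h
    simp only [f, Prod.mk.injEq, Subtype.mk.injEq] at h
    obtain ⟨rfl, rfl, h⟩ := h
    have : t = t' := by
      funext x
      by_cases hx : x ∈ Set.Icc (-K : ℤ) K
      · exact congrFun h ⟨x, hx⟩
      · exact (ht x hx).trans (ht' x hx).symm
    subst this
    rfl
  have : Finite (M.boundedConfigs K) := Finite.of_injective f hf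
  exact Set.toFinite _

theorem initConfig_mem_boundedConfigs (K : ℕ) : M.initConfig ∈ M.boundedConfigs K :=
  ⟨by simp [initConfig], fun _ _ => rfl⟩

/-- The superposition `ψ` involves only configurations in `M.boundedConfigs K`. -/
def IsBounded (K : ℕ) (ψ : M.Config →₀ ℝ) : Prop :=
  ∀ c, ψ c ≠ 0 → c ∈ M.boundedConfigs K

theorem isBounded_single_initConfig (K : ℕ) :
    M.IsBounded K (Finsupp.single M.initConfig 1) := by
  intro c hc
  by_cases h : c = M.initConfig
  · exact h ▸ M.initConfig_mem_boundedConfigs K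
  · exact absurd (Finsupp.single_eq_of_ne h) hc

variable {M}

theorem IsBounded.evolve {K : ℕ} {ψ : M.Config →₀ ℝ} (hψ : M.IsBounded K ψ) {σ : TapeSymbol α}
    {ω : M.Reg} (h : heads (M.evolve σ ω ψ) ⊆ Set.Icc (-K : ℤ) K) :
    M.IsBounded K (M.evolve σ ω ψ) := by
  intro c' hc'
  refine ⟨h ⟨c', hc', rfl⟩, fun z hz => ?_⟩
  obtain ⟨c, hc, hcol⟩ := M.exists_of_evolve_ne_zero hc'
  obtain ⟨q', γ', d, -, rfl⟩ := M.exists_of_column_ne_zero hcol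
  obtain ⟨hhead, htape⟩ := hψ c hc
  have hne : z ≠ c.head := fun h => hz (h ▸ hhead)
  simpa [next, Function.update_of_ne hne] using htape z hz

/-- Functions that agree on the superpositions occurring in a computation have the same sum over
its continuing branches. -/
theorem contSum_congr {K : ℕ} {w : List α} {p s r : List (TapeSymbol α)}
    (hw : inputTape w = p ++ s ++ r) {f g : (M.Config →₀ ℝ) → ℝ}
    (hfg : ∀ φ, M.IsReachable w (p ++ s).length φ → M.IsBounded K φ → f φ = g φ)
    {ψ : M.Config →₀ ℝ} (hreach : M.IsReachable w p.length ψ) (hbdd : M.IsBounded K ψ)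
    (hvis : M.visitedFrom (s ++ r) ψ ⊆ Set.Icc (-K : ℤ) K) :
    M.contSum f s ψ = M.contSum g s ψ := by
  induction s generalizing p ψ with
  | nil => exact hfg ψ (by simpa using hreach) hbdd
  | cons σ s ih =>
    have hσ : (inputTape w)[p.length]? = some σ :=
      getElem?_of_eq_append (s := s ++ r) (by simpa using hw)
    simp only [contSum]
    refine Finset.sum_congr rfl fun ω _ => ?_
    have := ih (p := p ++ [σ]) (ψ := M.evolve σ ω ψ) (by simpa using hw) (by simpa using hfg)
      (by simpa using hreach.evolve hσ ω)
      (hbdd.evolve ((M.heads_evolve_subset σ ω (s ++ r) ψ).trans hvis))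
    cases hω : M.regType ω with
    | none => exact this ((M.visitedFrom_evolve_subset hω (s ++ r) ψ).trans hvis)
    | some h => rfl

end RealTimeQTM

/-! ### A criterion for regularity -/

/-- Rabin's argument: suppose that the words are mapped to a bounded set of vectors, together with
a label from a finite set, and that for words with the same label the probabilities `p` after any
common continuation are close if the vectors are close, uniformly in the continuation. If `p`
separates `L` from its complement by a gap, then by compactness `L` has only finitely many left
quotients. -/
theorem isRegular_of_lipschitz {α ι κ : Type*} [Fintype ι] [Finite κ] {L : Language α}
    (v : List α → ι → ℝ) (B : ℝ) (hv : ∀ u i, |v u i| ≤ B) (k : List α → κ) (p : List α → ℝ)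
    (C : ℝ) (hC : 0 ≤ C)
    (hp : ∀ u u' s, k u = k u' → |p (u ++ s) - p (u' ++ s)| ≤ C * dist (v u) (v u'))
    (γ : ℝ) (hγ : 0 < γ) (hgap : ∀ w ∈ L, ∀ w' ∉ L, γ ≤ p w - p w') : L.IsRegular := by
  have hbdd : Bornology.IsBounded (Set.range v) := by
    refine (Metric.isBounded_closedBall (x := (0 : ι → ℝ)) (r := |B|)).subset ?_
    rintro _ ⟨u, rfl⟩
    rw [mem_closedBall_zero_iff, pi_norm_le_iff_of_nonneg (abs_nonneg B)]
    exact fun i => (hv u i).trans (le_abs_self B)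
  have htb : TotallyBounded (Set.range v) :=
    hbdd.isCompact_closure.totallyBounded.subset subset_closure
  set δ : ℝ := γ / (C + 1) with hδ
  have hδ0 : 0 < δ := by positivity
  obtain ⟨t, ht, hcov⟩ := Metric.totallyBounded_iff.1 htb (δ / 2) (by positivity)
  have hcov' : ∀ u, ∃ y : t, dist (v u) y < δ / 2 := by
    intro u
    obtain ⟨y, hy, hu⟩ := Set.mem_iUnion₂.1 (hcov ⟨u, rfl⟩)
    exact ⟨⟨y, hy⟩, hu⟩
  choose c hc using hcov'
  have := ht.to_subtype
  have key : ∀ u u', k u = k u' → c u = c u' → ∀ s, u ++ s ∈ L → u' ++ s ∈ L := by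
    intro u u' hk hcu s hs
    by_contra hs'
    have h1 := hgap _ hs _ hs'
    have h2 := (le_abs_self _).trans (hp u u' s hk)
    have h3 : dist (v u) (v u') ≤ δ := by
      have h4 := hc u
      have h5 := hc u'
      rw [← hcu] at h5
      linarith [dist_triangle_right (v u) (v u') (c u)]
    have h4 : C * dist (v u) (v u') ≤ C * δ := mul_le_mul_of_nonneg_left h3 hC
    have h5 : (C + 1) * δ = γ := by rw [hδ]; field_simp
    linarith
  have hfac : (L.leftQuotient).FactorsThrough fun u => (k u, c u) := by
    intro u u' h
    simp only [Prod.mk.injEq] at h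
    ext s
    exact ⟨key u u' h.1 h.2 s, key u' u h.1.symm h.2.symm s⟩
  obtain ⟨g, hg⟩ := (Function.factorsThrough_iff _).1 hfac
  refine Language.IsRegular.of_finite_range_leftQuotient ((Set.finite_range g).subset ?_)
  rw [hg]
  exact Set.range_comp_subset_range _ _

/-- Rejection with high probability bounds the probability of acceptance from above. -/
theorem RecognizesStd.exists_gap {α : Type} {p : Verdict → List α → ℝ} {L : Language α}
    (h : RecognizesStd p L) (hp : ∀ w, p .accept w + p .reject w ≤ 1) :
    ∃ γ : ℝ, 0 < γ ∧ ∀ w ∈ L, ∀ w' ∉ L, γ ≤ p .accept w - p .accept w' := by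
  obtain ⟨ε, -, hε, hacc, hrej⟩ := h
  refine ⟨1 - 2 * ε, by linarith, fun w hw w' hw' => ?_⟩
  linarith [hacc w hw, hrej w' hw', hp w']

theorem inputTape_append {α : Type} (u s : List α) :
    inputTape (u ++ s) = (TapeSymbol.leftEnd :: u.map TapeSymbol.letter) ++
      (s.map TapeSymbol.letter ++ [TapeSymbol.rightEnd]) := by
  simp [inputTape]

/-! ### Quantum finite automata recognize only regular languages -/

/-- The quadratic form is nonnegative on the sum and the difference of two basis vectors. -/
theorem abs_apply_le_of_posSemidef {n : Type*} [Fintype n] {A : Matrix n n ℝ}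
    (hA : A.PosSemidef) (i j : n) : |A i j| ≤ (A i i + A j j) / 2 := by
  classical
  have hsymm : A j i = A i j := by simpa using hA.isHermitian.apply i j
  have h1 := hA.dotProduct_mulVec_nonneg (Pi.single i 1 + Pi.single j 1)
  have h2 := hA.dotProduct_mulVec_nonneg (Pi.single i 1 - Pi.single j 1)
  simp [Matrix.mulVec_add, Matrix.mulVec_sub, hsymm] at h1 h2
  rw [abs_le]
  constructor <;> linarith

theorem abs_trace_mul_sub_le {n : Type*} [Fintype n] {P ρ ρ' : Matrix n n ℝ} {b : ℝ}
    (hP : ∀ i j, |P i j| ≤ 1) (hρ : ∀ i j, |ρ i j - ρ' i j| ≤ b) :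
    |(P * ρ).trace - (P * ρ').trace| ≤ (Fintype.card n : ℝ) ^ 2 * b := by
  have h1 : (P * ρ).trace - (P * ρ').trace = ∑ i, ∑ j, P i j * (ρ j i - ρ' j i) := by
    simp [Matrix.trace, Matrix.mul_apply, mul_sub, Finset.sum_sub_distrib]
  rw [h1]
  calc |∑ i, ∑ j, P i j * (ρ j i - ρ' j i)|
      ≤ ∑ i, ∑ j, |P i j * (ρ j i - ρ' j i)| :=
        (Finset.abs_sum_le_sum_abs _ _).trans
          (Finset.sum_le_sum fun i _ => Finset.abs_sum_le_sum_abs _ _)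
    _ ≤ ∑ _i : n, ∑ _j : n, b := by
        refine Finset.sum_le_sum fun i _ => Finset.sum_le_sum fun j _ => ?_
        rw [abs_mul]
        exact (mul_le_of_le_one_left (abs_nonneg _) (hP i j)).trans (hρ j i)
    _ = (Fintype.card n : ℝ) ^ 2 * b := by simp; ring

/-- Operators evolved in the Heisenberg picture: `heisenberg A P s` is the observable whose
expectation before reading the symbols of `s` with the operation elements `A` is that of `P`
afterwards. -/
def heisenberg {α S : Type} [Fintype S] {ι : TapeSymbol α → Type} [∀ σ, Fintype (ι σ)]
    (A : ∀ σ, ι σ → Matrix S S ℝ) (P : Matrix S S ℝ) : List (TapeSymbol α) → Matrix S S ℝ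
  | [] => P
  | σ :: s => ∑ i, (A σ i)ᴴ * heisenberg A P s * A σ i

namespace RealTimeQFA

variable {α H : Type} (M : RealTimeQFA α H)

theorem trace_superop (σ : TapeSymbol α) (ρ : Matrix M.State M.State ℝ) :
    (M.superop σ ρ).trace = ρ.trace := by
  simp only [superop, Matrix.trace_sum]
  have : ∀ i, (M.E σ i * ρ * (M.E σ i)ᴴ).trace = ((M.E σ i)ᴴ * M.E σ i * ρ).trace := fun i => by
    rw [Matrix.trace_mul_comm, Matrix.mul_assoc]
  simp only [this]
  rw [← Matrix.trace_sum, ← Finset.sum_mul, M.complete, one_mul]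

theorem posSemidef_superop (σ : TapeSymbol α) {ρ : Matrix M.State M.State ℝ}
    (hρ : ρ.PosSemidef) : (M.superop σ ρ).PosSemidef :=
  Matrix.posSemidef_sum _ fun i _ => hρ.mul_mul_conjTranspose_same (M.E σ i)

theorem density_append_singleton (s : List (TapeSymbol α)) (σ : TapeSymbol α) :
    M.density (s ++ [σ]) = M.superop σ (M.density s) := by
  simp [density]

theorem posSemidef_density (s : List (TapeSymbol α)) : (M.density s).PosSemidef := by
  induction s using List.reverseRecOn with
  | nil =>
    have : M.density [] = Matrix.diagonal (Pi.single M.start 1) := by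
      simp [density, Matrix.diagonal_single]
    rw [this, Matrix.posSemidef_diagonal_iff]
    intro i
    by_cases h : i = M.start
    · subst h; simp
    · simp [h]
  | append_singleton s σ ih =>
    rw [density_append_singleton]
    exact M.posSemidef_superop σ ih

theorem trace_density (s : List (TapeSymbol α)) : (M.density s).trace = 1 := by
  induction s using List.reverseRecOn with
  | nil => simp [density]
  | append_singleton s σ ih => rw [density_append_singleton, trace_superop, ih]

theorem abs_density_le (s : List (TapeSymbol α)) (i j : M.State) : |M.density s i j| ≤ 1 := by
  have h0 := M.posSemidef_density s
  have hle : ∀ q, M.density s q q ≤ 1 := by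
    intro q
    rw [← M.trace_density s]
    exact Finset.single_le_sum (f := fun q => M.density s q q) (fun q _ => h0.diag_nonneg)
      (Finset.mem_univ q)
  linarith [abs_apply_le_of_posSemidef h0 i j, hle i, hle j]

variable [DecidableEq H]

/-- The observable on the states before reading the symbols of a list that corresponds to
observing `h` afterwards. -/
def effect (h : H) (s : List (TapeSymbol α)) : Matrix M.State M.State ℝ :=
  heisenberg M.E (M.proj h) s

theorem effect_nil (h : H) : M.effect h [] = M.proj h := rfl

theorem effect_cons (h : H) (σ : TapeSymbol α) (s : List (TapeSymbol α)) :
    M.effect h (σ :: s) = ∑ i, (M.E σ i)ᴴ * M.effect h s * M.E σ i := rfl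

theorem trace_proj_mul_foldl (h : H) (s : List (TapeSymbol α)) (ρ : Matrix M.State M.State ℝ) :
    (M.proj h * s.foldl (fun ρ σ => M.superop σ ρ) ρ).trace = (M.effect h s * ρ).trace := by
  induction s generalizing ρ with
  | nil => rfl
  | cons σ s ih =>
    rw [List.foldl_cons, ih, effect_cons, superop, Finset.mul_sum, Finset.sum_mul, Matrix.trace_sum,
      Matrix.trace_sum]
    refine Finset.sum_congr rfl fun i _ => ?_
    rw [← Matrix.mul_assoc, Matrix.trace_mul_comm]
    simp only [Matrix.mul_assoc]

theorem posSemidef_effect (h : H) (s : List (TapeSymbol α)) :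
    (M.effect h s).PosSemidef ∧ (1 - M.effect h s).PosSemidef := by
  induction s with
  | nil =>
    constructor
    · rw [effect_nil, proj, Matrix.posSemidef_diagonal_iff]
      intro q
      split_ifs <;> norm_num
    · rw [effect_nil, proj, ← Matrix.diagonal_one, Matrix.diagonal_sub,
        Matrix.posSemidef_diagonal_iff]
      intro q
      split_ifs <;> norm_num
  | cons σ s ih =>
    constructor
    · rw [effect_cons]
      exact Matrix.posSemidef_sum _ fun i _ => ih.1.conjTranspose_mul_mul_same (M.E σ i)
    · have : 1 - M.effect h (σ :: s) = ∑ i, (M.E σ i)ᴴ * (1 - M.effect h s) * M.E σ i := by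
        simp only [mul_sub, sub_mul, mul_one, Finset.sum_sub_distrib, M.complete, effect_cons]
      rw [this]
      exact Matrix.posSemidef_sum _ fun i _ => ih.2.conjTranspose_mul_mul_same (M.E σ i)

theorem abs_effect_le (h : H) (s : List (TapeSymbol α)) (i j : M.State) :
    |M.effect h s i j| ≤ 1 := by
  obtain ⟨h0, h1⟩ := M.posSemidef_effect h s
  have hi := h1.diag_nonneg (i := i)
  have hj := h1.diag_nonneg (i := j)
  simp only [Matrix.sub_apply, Matrix.one_apply_eq] at hi hj
  linarith [abs_apply_le_of_posSemidef h0 i j]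

theorem prob_append (h : H) (u s : List α) :
    M.prob h (u ++ s) = (M.effect h (s.map TapeSymbol.letter ++ [TapeSymbol.rightEnd]) *
      M.density (TapeSymbol.leftEnd :: u.map TapeSymbol.letter)).trace := by
  rw [prob, inputTape_append, density, List.foldl_append, trace_proj_mul_foldl]
  rfl

theorem sum_prob [Fintype H] (w : List α) : ∑ h, M.prob h w = 1 := by
  have : ∑ h, M.proj h = 1 := by
    ext i j
    simp only [proj, Matrix.sum_apply, Matrix.diagonal_apply, Matrix.one_apply]
    by_cases hij : i = j <;> simp [hij]
  simp only [prob]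
  rw [← Matrix.trace_sum, ← Finset.sum_mul, this, one_mul, trace_density]

end RealTimeQFA

theorem BQAL_subset_REG : BQAL ⊆ REG := by
  rintro L ⟨M, hM⟩
  obtain ⟨γ, hγ, hgap⟩ := hM.exists_gap
    (fun w => by rw [← sum_verdict fun h => M.prob h w, M.sum_prob])
  refine isRegular_of_lipschitz
    (fun u (ij : M.State × M.State) =>
      M.density (TapeSymbol.leftEnd :: u.map TapeSymbol.letter) ij.1 ij.2) 1
    (fun u ij => M.abs_density_le _ _ _) (fun _ => ()) (M.prob Verdict.accept)
    ((Fintype.card M.State : ℝ) ^ 2) (by positivity) (fun u u' s _ => ?_) γ hγ hgap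
  rw [M.prob_append, M.prob_append]
  refine abs_trace_mul_sub_le (M.abs_effect_le _ _) fun i j => ?_
  rw [← Real.dist_eq]
  exact dist_le_pi_dist (fun ij : M.State × M.State =>
    M.density (TapeSymbol.leftEnd :: u.map TapeSymbol.letter) ij.1 ij.2)
    (fun ij => M.density (TapeSymbol.leftEnd :: u'.map TapeSymbol.letter) ij.1 ij.2) (i, j)

/-! ### Constant-space machines recognize only regular languages -/

namespace RealTimeQTM

variable {α H : Type} {M : RealTimeQTM α H}

/-- Reachability in `t` steps depends only on the first `t` symbols of the input tape. -/
theorem Reachable.congr {w w' : List α} {t : ℕ} {c : M.Config} (hc : M.Reachable w t c)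
    (h : ∀ i < t, (inputTape w)[i]? = (inputTape w')[i]?) : M.Reachable w' t c := by
  induction hc with
  | init => exact .init
  | @step t c c' σ ω _ hσ hcol ih =>
    exact .step ω (ih fun i hi => h i (hi.trans t.lt_succ_self)) (h t t.lt_succ_self ▸ hσ) hcol

theorem reachable_append_iff {u s : List α} {c : M.Config} :
    M.Reachable (u ++ s) (u.length + 1) c ↔ M.Reachable u (u.length + 1) c := by
  have h : ∀ i < u.length + 1, (inputTape (u ++ s))[i]? = (inputTape u)[i]? := by
    intro i hi
    have hu := inputTape_append u []
    rw [List.append_nil] at hu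
    rw [inputTape_append, hu, List.getElem?_append_left (by simpa using hi),
      List.getElem?_append_left (by simpa using hi)]
  exact ⟨fun hc => hc.congr h, fun hc => hc.congr fun i hi => (h i hi).symm⟩

theorem bilinForm_eq_sum (B : LinearMap.BilinForm ℝ (M.Config →₀ ℝ)) {F : Finset M.Config}
    {ψ : M.Config →₀ ℝ} (hF : ∀ c, ψ c ≠ 0 → c ∈ F) :
    B ψ ψ = ∑ x : F × F,
      B (Finsupp.single x.1.1 1) (Finsupp.single x.2.1 1) * (ψ x.1 * ψ x.2) := by
  have h1 : ψ = ∑ c : F, ψ c • Finsupp.single c.1 (1 : ℝ) := by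
    rw [Finset.sum_coe_sort F fun c => ψ c • Finsupp.single c (1 : ℝ)]
    conv_lhs => rw [← Finsupp.sum_single ψ]
    rw [Finsupp.sum_of_support_subset ψ (fun c hc => hF c (Finsupp.mem_support_iff.1 hc)) _
      (by simp)]
    simp
  conv_lhs => rw [h1]
  rw [Fintype.sum_prod_type]
  simp only [map_sum, LinearMap.sum_apply, map_smul, LinearMap.smul_apply, smul_eq_mul]
  rw [Finset.sum_comm]
  refine Finset.sum_congr rfl fun c _ => ?_
  rw [Finset.mul_sum]
  exact Finset.sum_congr rfl fun c' _ => by ring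

/-- The entry at `(c, c')` of the unnormalized density matrix with which the computation continues
after reading the left end-marker and the word `u`. -/
noncomputable def contDensity (M : RealTimeQTM α H) (u : List α) (c c' : M.Config) : ℝ :=
  M.contSum (fun ψ => ψ c * ψ c') (TapeSymbol.leftEnd :: u.map TapeSymbol.letter)
    (Finsupp.single M.initConfig 1)

variable [DecidableEq H]

/-- On reachable configurations the matrix of the quadratic form `M.haltProb h s` has bounded
entries, by polarization. -/
theorem WellFormed.abs_bilinForm_le [Fintype H] (hM : M.WellFormed) {w : List α}
    {p s : List (TapeSymbol α)} (hw : inputTape w = p ++ s) {h : H}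
    {B : LinearMap.BilinForm ℝ (M.Config →₀ ℝ)} (hsymm : ∀ φ ψ, B φ ψ = B ψ φ)
    (hB : ∀ ψ, M.haltProb h s ψ = B ψ ψ) {c c' : M.Config} (hc : M.Reachable w p.length c)
    (hc' : M.Reachable w p.length c') :
    |B (Finsupp.single c 1) (Finsupp.single c' 1)| ≤ 1 := by
  classical
  set φ : M.Config →₀ ℝ := Finsupp.single c 1 with hφ
  set ψ : M.Config →₀ ℝ := Finsupp.single c' 1 with hψ
  have hφr : M.IsReachable w p.length φ := .single hc 1
  have hψr : M.IsReachable w p.length ψ := .single hc' 1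
  have hw' : inputTape w = p ++ s ++ [] := by simpa using hw
  have h1 := hM.haltProb_le hw' (hφr.add hψr) h
  have h2 := hM.haltProb_le hw' (hφr.add hψr.neg) h
  have h3 := M.haltProb_nonneg h s (φ + ψ)
  have h4 := M.haltProb_nonneg h s (φ + -ψ)
  rw [hB, normSq_eq_dot] at h1 h2
  rw [hB] at h3 h4
  have hd : dot φ ψ ≤ 1 ∧ -1 ≤ dot φ ψ := by
    rw [hφ, hψ, dot_single_single]
    split_ifs <;> norm_num
  have hφφ : dot φ φ = 1 := by rw [hφ, dot_single_single]; simp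
  have hψψ : dot ψ ψ = 1 := by rw [hψ, dot_single_single]; simp
  simp only [map_add, map_neg, LinearMap.add_apply, LinearMap.neg_apply, hsymm ψ φ,
    dot_comm ψ φ, hφφ, hψψ] at h1 h2 h3 h4
  rw [abs_le]
  constructor <;> linarith [hd.1, hd.2]

theorem WellFormed.abs_contDensity_le [Fintype H] (hM : M.WellFormed) (u : List α)
    (c c' : M.Config) : |M.contDensity u c c'| ≤ 1 := by
  have h1 : ∀ ψ : M.Config →₀ ℝ, |ψ c * ψ c'| ≤ normSq ψ := by
    intro ψ
    rw [normSq_eq_dot, abs_mul]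
    have h2 := sq_le_dot_self ψ c
    have h3 := sq_le_dot_self ψ c'
    rw [← sq_abs] at h2 h3
    nlinarith [sq_nonneg (|ψ c| - |ψ c'|)]
  refine (M.abs_contSum_le h1 _ _).trans ?_
  have := hM.contSum_normSq_le (w := u) (p := []) (r := [TapeSymbol.rightEnd])
    (s := TapeSymbol.leftEnd :: u.map TapeSymbol.letter) (by simp [inputTape])
    (IsReachable.single Reachable.init 1)
  simpa [normSq_single] using this

theorem prob_append (h : H) (u s : List α) :
    M.prob h (u ++ s) =
      M.haltProb h (TapeSymbol.leftEnd :: u.map TapeSymbol.letter)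
        (Finsupp.single M.initConfig 1) +
      M.contSum (M.haltProb h (s.map TapeSymbol.letter ++ [TapeSymbol.rightEnd]))
        (TapeSymbol.leftEnd :: u.map TapeSymbol.letter) (Finsupp.single M.initConfig 1) := by
  rw [prob, inputTape_append, haltProb_append]

theorem isRegular_of_isConstantSpaceQTM [Fintype H] (hM : IsConstantSpaceQTM M) {L : Language α}
    (h : H) {γ : ℝ} (hγ : 0 < γ) (hgap : ∀ w ∈ L, ∀ w' ∉ L, γ ≤ M.prob h w - M.prob h w') :
    L.IsRegular := by
  classical
  have hwf := hM.wellFormed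
  obtain ⟨K, hK⟩ := hM.constantSpace
  let F : Finset M.Config := (M.finite_boundedConfigs K).toFinset
  let pre (u : List α) : List (TapeSymbol α) := TapeSymbol.leftEnd :: u.map TapeSymbol.letter
  let suf (s : List α) : List (TapeSymbol α) := s.map TapeSymbol.letter ++ [TapeSymbol.rightEnd]
  let init : M.Config →₀ ℝ := Finsupp.single M.initConfig 1
  choose B hsymm hB using fun s : List α => M.exists_bilinForm_haltProb h (suf s)
  -- The bounds on `B s` hold only on reachable configurations, so the words are labelled with
  -- the set of configurations in `F` that they reach.
  let k (u : List α) : Set F := {c | M.Reachable u (u.length + 1) c}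
  let b (κ : Set F) (s : List α) (x : F × F) : ℝ :=
    if x.1 ∈ κ ∧ x.2 ∈ κ then B s (Finsupp.single x.1.1 1) (Finsupp.single x.2.1 1) else 0
  have hb : ∀ u s x, |b (k u) s x| ≤ 1 := by
    intro u s x
    simp only [b]
    split_ifs with hx
    · refine hwf.abs_bilinForm_le (p := pre u) (inputTape_append u s) (hsymm s) (hB s) ?_ ?_
      · simpa [pre] using reachable_append_iff.2 hx.1
      · simpa [pre] using reachable_append_iff.2 hx.2
    · simp
  have hprob : ∀ u s, M.prob h (u ++ s) = M.haltProb h (pre u) init +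
      ∑ x, b (k u) s x * M.contDensity u x.1 x.2 := by
    intro u s
    rw [prob_append]
    congr 1
    refine Eq.trans ?_ (M.contSum_sum_mul Finset.univ (b (k u) s)
      (fun x ψ => ψ x.1 * ψ x.2) (pre u) init)
    refine contSum_congr (K := K) (w := u ++ s) (p := []) (r := suf s) (s := pre u)
      (inputTape_append u s) ?_ (IsReachable.single Reachable.init 1)
      (M.isBounded_single_initConfig K) ?_
    · intro φ hreach hbdd
      have hφF : ∀ c, φ c ≠ 0 → c ∈ F := fun c hc => by simpa [F] using hbdd c hc
      change M.haltProb h (suf s) φ = _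
      rw [hB, bilinForm_eq_sum _ hφF]
      refine Finset.sum_congr rfl fun x _ => ?_
      simp only [b]
      split_ifs with hx
      · rfl
      · have hk : ∀ c : F, φ c ≠ 0 → c ∈ k u := fun c hc =>
          reachable_append_iff.1 (by simpa [pre] using hreach c hc)
        have : φ x.1 * φ x.2 = 0 := by
          by_contra h0
          exact hx ⟨hk _ (left_ne_zero_of_mul h0), hk _ (right_ne_zero_of_mul h0)⟩
        rw [this, mul_zero, mul_zero]
    · have := M.visited_subset_Icc (hK (u ++ s))
      rwa [visited, inputTape_append] at this
  let v (u : List α) : Option (F × F) → ℝ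
    | none => M.haltProb h (pre u) init
    | some x => M.contDensity u x.1 x.2
  refine isRegular_of_lipschitz v 1 ?_ k (M.prob h) (1 + Fintype.card (F × F)) (by positivity)
    ?_ γ hγ hgap
  · rintro u (_ | x)
    · change |M.haltProb h (pre u) init| ≤ 1
      rw [abs_of_nonneg (M.haltProb_nonneg _ _ _)]
      have := hwf.haltProb_le (w := u) (p := []) (s := pre u) (r := [TapeSymbol.rightEnd])
        (by simp [inputTape, pre]) (IsReachable.single Reachable.init 1) h
      simpa [normSq_single] using this
    · exact hwf.abs_contDensity_le u _ _
  · intro u u' s hk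
    have hcoord : ∀ o, |v u o - v u' o| ≤ dist (v u) (v u') := fun o => by
      rw [← Real.dist_eq]
      exact dist_le_pi_dist _ _ o
    have h1 : M.prob h (u ++ s) - M.prob h (u' ++ s) = (v u none - v u' none) +
        ∑ x, b (k u) s x * (v u (some x) - v u' (some x)) := by
      rw [hprob, hprob, ← hk]
      simp only [v, mul_sub, Finset.sum_sub_distrib]
      ring
    rw [h1, add_mul, one_mul]
    refine (abs_add_le _ _).trans (add_le_add (hcoord none) ?_)
    refine (Finset.abs_sum_le_sum_abs _ _).trans ?_
    rw [← nsmul_eq_mul]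
    refine Finset.sum_le_card_nsmul _ _ _ fun x _ => ?_
    rw [abs_mul]
    exact (mul_le_of_le_one_left (abs_nonneg _) (hb u s x)).trans (hcoord (some x))

end RealTimeQTM

theorem rtBQSPACE1_subset_REG : rtBQSPACE1 ⊆ REG := by
  rintro L ⟨M, hM, hL⟩
  obtain ⟨γ, hγ, hgap⟩ := hL.exists_gap fun w => by
    rw [← sum_verdict fun v => M.prob v w]
    exact hM.wellFormed.sum_prob_le w
  exact M.isRegular_of_isConstantSpaceQTM hM Verdict.accept hγ hgap

/-! ### From constant-space machines to quantum finite automata with postselection -/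

/-- If all operation elements fix the state `n` up to a factor, an observable that vanishes on `n`
stays so. -/
theorem heisenberg_apply_self_of_column_eq_zero {α S : Type} [Fintype S]
    {ι : TapeSymbol α → Type} [∀ σ, Fintype (ι σ)] (A : ∀ σ, ι σ → Matrix S S ℝ)
    {P : Matrix S S ℝ} {n : S} (hA : ∀ σ i q, q ≠ n → A σ i q n = 0) (hP : P n n = 0)
    (s : List (TapeSymbol α)) : heisenberg A P s n n = 0 := by
  induction s with
  | nil => exact hP
  | cons σ s ih =>
    simp only [heisenberg, Matrix.sum_apply, Matrix.mul_apply, Matrix.conjTranspose_apply]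
    refine Finset.sum_eq_zero fun i _ => ?_
    rw [Finset.sum_eq_single n, Finset.sum_eq_single n, ih]
    · simp
    · intro q _ hq; simp [hA σ i q hq]
    · simp
    · intro q _ hq; simp [hA σ i q hq]
    · simp

/-- Every symmetric matrix is, up to scaling, at most the identity. -/
theorem exists_posSemidef_one_sub_smul {S : Type} [Fintype S] [DecidableEq S] {G : Matrix S S ℝ}
    (hG : G.IsHermitian) : ∃ r : ℝ, 0 < r ∧ (1 - (r ^ 2) • G).PosSemidef := by
  set b : ℝ := ∑ i, ∑ j, |G i j| with hb
  have hb0 : 0 ≤ b := Finset.sum_nonneg fun i _ => Finset.sum_nonneg fun j _ => abs_nonneg _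
  -- The quadratic form of `G` is at most `b` times the squared norm.
  refine ⟨1 / (b + 1), by positivity, Matrix.PosSemidef.of_dotProduct_mulVec_nonneg ?_ ?_⟩
  · exact Matrix.isHermitian_one.sub (hG.smul (IsSelfAdjoint.all _))
  · intro x
    have hx0 : 0 ≤ x ⬝ᵥ x := Finset.sum_nonneg fun i _ => mul_self_nonneg _
    have hxi : ∀ i, x i ^ 2 ≤ x ⬝ᵥ x := fun i => by
      rw [pow_two]
      exact Finset.single_le_sum (f := fun i => x i * x i) (fun i _ => mul_self_nonneg _)
        (Finset.mem_univ i)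
    have h1 : x ⬝ᵥ (G *ᵥ x) ≤ b * (x ⬝ᵥ x) := by
      have h0 : x ⬝ᵥ (G *ᵥ x) = ∑ i, ∑ j, x i * (G i j * x j) := by
        simp only [dotProduct, Matrix.mulVec, Finset.mul_sum]
      rw [h0, hb, Finset.sum_mul]
      refine Finset.sum_le_sum fun i _ => ?_
      rw [Finset.sum_mul]
      refine Finset.sum_le_sum fun j _ => ?_
      have h2 : x i * (G i j * x j) ≤ |G i j| * (|x i| * |x j|) := by
        calc x i * (G i j * x j) ≤ |x i * (G i j * x j)| := le_abs_self _
          _ = |G i j| * (|x i| * |x j|) := by rw [abs_mul, abs_mul]; ring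
      refine h2.trans (mul_le_mul_of_nonneg_left ?_ (abs_nonneg _))
      have hi := hxi i
      have hj := hxi j
      rw [← sq_abs] at hi hj
      nlinarith [sq_nonneg (|x i| - |x j|)]
    have h3 : (1 / (b + 1)) ^ 2 * b ≤ 1 := by
      rw [div_pow, one_pow, div_mul_eq_mul_div, one_mul, div_le_one (by positivity)]
      nlinarith
    simp only [star_trivial, Matrix.sub_mulVec, Matrix.one_mulVec, Matrix.smul_mulVec,
      dotProduct_sub, dotProduct_smul, smul_eq_mul]
    have h4 := mul_le_mul_of_nonneg_left h1 (sq_nonneg (1 / (b + 1)))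
    nlinarith [mul_le_mul_of_nonneg_right h3 hx0]

open scoped MatrixOrder in
theorem exists_conjTranspose_mul_self_eq {S : Type} [Fintype S] [DecidableEq S]
    {G : Matrix S S ℝ} (hG : G.PosSemidef) : ∃ D : Matrix S S ℝ, Dᴴ * D = G := by
  obtain ⟨D, hD⟩ := CStarAlgebra.nonneg_iff_eq_star_mul_self.1 hG.nonneg
  exact ⟨D, hD.symm⟩

/-- Because of postselection, arbitrary operation elements may be used: they are scaled down and
completed by operation elements that lead to a nonpostselected sink `n`. Scaling affects
acceptance and rejection in the same way. -/
theorem exists_postQFA {α S : Type} [Fintype S] [DecidableEq S] {ι : TapeSymbol α → Type}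
    [∀ σ, Fintype (ι σ)] (A : ∀ σ, ι σ → Matrix S S ℝ) (start n : S) (type : S → PostVerdict)
    (hn : type n = .nonpost) (hA : ∀ σ i q, q ≠ n → A σ i q n = 0) :
    ∃ (M : RealTimeQFA α PostVerdict) (c : List (TapeSymbol α) → ℝ), (∀ s, 0 < c s) ∧
      ∀ h ≠ PostVerdict.nonpost, ∀ w, M.prob h w = c (inputTape w) *
        heisenberg A (Matrix.diagonal fun q => if type q = h then 1 else 0) (inputTape w)
          start start := by
  have hG : ∀ σ, (∑ i, (A σ i)ᴴ * A σ i).IsHermitian := fun σ =>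
    (Matrix.posSemidef_sum _ fun i _ => Matrix.posSemidef_conjTranspose_mul_self _).isHermitian
  choose r hr hpos using fun σ => exists_posSemidef_one_sub_smul (hG σ)
  choose D hD using fun σ => exists_conjTranspose_mul_self_eq (hpos σ)
  let E (σ : TapeSymbol α) : ι σ ⊕ S → Matrix S S ℝ :=
    Sum.elim (fun i => r σ • A σ i) fun j => Matrix.single n j 1 * D σ
  -- The completing elements see only the expectation of an observable `X` in the sink `n`, which
  -- vanishes for the observables of acceptance and rejection.
  have hE : ∀ σ (X : Matrix S S ℝ), ∑ i, (E σ i)ᴴ * X * E σ i =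
      (r σ) ^ 2 • ∑ i, (A σ i)ᴴ * X * A σ i +
        X n n • (1 - (r σ) ^ 2 • ∑ i, (A σ i)ᴴ * A σ i) := by
    intro σ X
    rw [Fintype.sum_sum_type]
    congr 1
    · simp only [E, Sum.elim_inl, Matrix.conjTranspose_smul, star_trivial, Matrix.smul_mul,
        Matrix.mul_smul, smul_smul, ← pow_two, Finset.smul_sum]
    · have h1 : ∀ j, (E σ (Sum.inr j))ᴴ * X * E σ (Sum.inr j) =
          (D σ)ᴴ * (X n n • Matrix.single j j 1) * D σ := by
        intro j
        simp only [E, Sum.elim_inr, Matrix.conjTranspose_mul, Matrix.conjTranspose_single,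
          star_trivial]
        have h2 : Matrix.single j n 1 * X * Matrix.single n j 1 =
            X n n • Matrix.single j j (1 : ℝ) := by
          rw [Matrix.single_mul_mul_single]
          simp [Matrix.smul_single]
        rw [← h2]
        simp only [Matrix.mul_assoc]
      simp only [h1]
      rw [← Finset.sum_mul, ← Finset.mul_sum, ← Finset.smul_sum, Matrix.sum_single_one, ← hD]
      simp
  let M : RealTimeQFA α PostVerdict :=
    { State := S
      stateFintype := inferInstance
      stateDecidableEq := inferInstance
      start := start
      num := fun σ => Fintype.card (ι σ ⊕ S)
      E := fun σ i => E σ ((Fintype.equivFin (ι σ ⊕ S)).symm i)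
      stateType := type
      complete := fun σ => by
        rw [Equiv.sum_comp (Fintype.equivFin (ι σ ⊕ S)).symm fun i => (E σ i)ᴴ * E σ i]
        have := hE σ 1
        simpa using this }
  let c : List (TapeSymbol α) → ℝ := fun s => (s.map fun σ => (r σ) ^ 2).prod
  refine ⟨M, c, fun s => ?_, fun h hh w => ?_⟩
  · refine List.prod_pos fun x hx => ?_
    obtain ⟨σ, -, rfl⟩ := List.mem_map.1 hx
    exact pow_pos (hr σ) 2
  · set P : Matrix S S ℝ := Matrix.diagonal fun q => if type q = h then 1 else 0 with hP
    have hPn : P n n = 0 := by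
      rw [hP, Matrix.diagonal_apply_eq, hn, if_neg (Ne.symm hh)]
    have key : ∀ s, M.effect h s = c s • heisenberg A P s := by
      intro s
      induction s with
      | nil => simp [RealTimeQFA.effect_nil, heisenberg, c, RealTimeQFA.proj, hP, M]
      | cons σ s ih =>
        have h1 := heisenberg_apply_self_of_column_eq_zero A hA hPn s
        rw [RealTimeQFA.effect_cons, ih]
        change ∑ i : Fin (Fintype.card (ι σ ⊕ S)), (E σ ((Fintype.equivFin _).symm i))ᴴ *
          (c s • heisenberg A P s) * E σ ((Fintype.equivFin _).symm i) = _
        rw [Equiv.sum_comp (Fintype.equivFin (ι σ ⊕ S)).symm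
          fun i => (E σ i)ᴴ * (c s • heisenberg A P s) * E σ i, hE]
        simp only [Matrix.smul_apply, h1, smul_zero, zero_smul, add_zero, heisenberg,
          Matrix.mul_smul, Matrix.smul_mul, ← Finset.smul_sum, smul_smul]
        simp [c]
    rw [RealTimeQFA.prob, RealTimeQFA.density, RealTimeQFA.trace_proj_mul_foldl, key,
      Matrix.trace_mul_single]
    simp [M]

namespace RealTimeQTM

variable {α : Type} (M : RealTimeQTM α PostVerdict) (K : ℕ)

/-- The configurations in `M.boundedConfigs K` as a finite set. -/
noncomputable def boundedFinset : Finset M.Config := (M.finite_boundedConfigs K).toFinset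

/-- The coordinates of a superposition, with no weight on the halting outcomes. -/
noncomputable def coords (ψ : M.Config →₀ ℝ) : M.boundedFinset K ⊕ PostVerdict → ℝ :=
  Sum.elim (fun c => ψ c) 0

open Classical in
/-- Operation elements that simulate a step of `M` in bounded space. The elements `(ω, none)`
apply `E_ω` if the computation continues, the elements `(ω, some c)` collect the weight of the
configuration `c` in the halting outcome of `ω`, and the remaining ones preserve the outcomes. -/
noncomputable def kraus (σ : TapeSymbol α) :
    (M.Reg × Option (M.boundedFinset K)) ⊕ PostVerdict →
      Matrix (M.boundedFinset K ⊕ PostVerdict) (M.boundedFinset K ⊕ PostVerdict) ℝ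
  | .inl (ω, none) =>
    if M.regType ω = none then
      Matrix.of (Sum.elim (fun c' => Sum.elim (fun c => M.column σ ω c c') 0) 0)
    else 0
  | .inl (ω, some c') =>
    match M.regType ω with
    | none => 0
    | some h => Matrix.of (Sum.elim 0 fun h' => if h' = h then
        Sum.elim (fun c => M.column σ ω c c') 0 else 0)
  | .inr h => Matrix.single (.inr h) (.inr h) 1

theorem quad_heisenberg_cons {S : Type} [Fintype S] {ι : TapeSymbol α → Type}
    [∀ σ, Fintype (ι σ)] (A : ∀ σ, ι σ → Matrix S S ℝ) (P : Matrix S S ℝ) (σ : TapeSymbol α)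
    (s : List (TapeSymbol α)) (x : S → ℝ) :
    x ⬝ᵥ (heisenberg A P (σ :: s) *ᵥ x) =
      ∑ i, (A σ i *ᵥ x) ⬝ᵥ (heisenberg A P s *ᵥ (A σ i *ᵥ x)) := by
  simp only [heisenberg, Matrix.sum_mulVec, dotProduct_sum]
  refine Finset.sum_congr rfl fun i _ => ?_
  rw [← Matrix.mulVec_mulVec, ← Matrix.mulVec_mulVec, Matrix.dotProduct_mulVec,
    Matrix.vecMul_conjTranspose]
  simp

variable {M K}

theorem evolve_apply_of_isBounded {ψ : M.Config →₀ ℝ} (hψ : M.IsBounded K ψ)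
    (σ : TapeSymbol α) (ω : M.Reg) (c' : M.Config) :
    M.evolve σ ω ψ c' = ∑ c : M.boundedFinset K, M.column σ ω c c' * ψ c := by
  rw [Finset.sum_coe_sort (M.boundedFinset K) fun c => M.column σ ω c c' * ψ c, evolve,
    Finsupp.sum_apply, Finsupp.sum_of_support_subset ψ (s := M.boundedFinset K)]
  · exact Finset.sum_congr rfl fun c _ => by simp [mul_comm]
  · exact fun c hc => by simpa [boundedFinset] using hψ c (Finsupp.mem_support_iff.1 hc)
  · simp

theorem normSq_of_isBounded {ψ : M.Config →₀ ℝ} (hψ : M.IsBounded K ψ) :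
    normSq ψ = ∑ c : M.boundedFinset K, ψ c ^ 2 := by
  rw [Finset.sum_coe_sort (M.boundedFinset K) fun c => ψ c ^ 2, normSq,
    Finsupp.sum_of_support_subset ψ (s := M.boundedFinset K)]
  · exact fun c hc => by simpa [boundedFinset] using hψ c (Finsupp.mem_support_iff.1 hc)
  · simp

theorem kraus_none_mulVec_coords {ψ : M.Config →₀ ℝ} (hψ : M.IsBounded K ψ)
    (σ : TapeSymbol α) (ω : M.Reg) : M.kraus K σ (.inl (ω, none)) *ᵥ M.coords K ψ =
      if M.regType ω = none then M.coords K (M.evolve σ ω ψ) else 0 := by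
  simp only [kraus]
  split_ifs
  · funext q
    cases q with
    | inl c' => simp [Matrix.mulVec, dotProduct, coords, evolve_apply_of_isBounded hψ]
    | inr h => simp [Matrix.mulVec, dotProduct, coords]
  · exact Matrix.zero_mulVec _

theorem kraus_some_mulVec_coords [DecidableEq M.Config] {ψ : M.Config →₀ ℝ} (hψ : M.IsBounded K ψ)
    (σ : TapeSymbol α) {ω : M.Reg} (c' : M.boundedFinset K) {h : PostVerdict}
    (hω : M.regType ω = some h) : M.kraus K σ (.inl (ω, some c')) *ᵥ M.coords K ψ =
      M.evolve σ ω ψ c' • Pi.single (.inr h) 1 := by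
  simp only [kraus, hω]
  funext q
  cases q with
  | inl c => simp [Matrix.mulVec, dotProduct]
  | inr h' =>
    by_cases hh : h' = h
    · subst hh
      simp [Matrix.mulVec, dotProduct, coords, evolve_apply_of_isBounded hψ]
    · simp [Matrix.mulVec, dotProduct, hh]

theorem kraus_inr_mulVec_coords (ψ : M.Config →₀ ℝ) (σ : TapeSymbol α) (h : PostVerdict) :
    M.kraus K σ (.inr h) *ᵥ M.coords K ψ = 0 := by
  simp [kraus, Matrix.single_mulVec, coords]

theorem kraus_inl_apply_inr (σ : TapeSymbol α) (i : M.Reg × Option (M.boundedFinset K))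
    (q : M.boundedFinset K ⊕ PostVerdict) (h : PostVerdict) :
    M.kraus K σ (.inl i) q (.inr h) = 0 := by
  obtain ⟨ω, _ | c⟩ := i
  · simp only [kraus]
    split_ifs
    · cases q <;> simp
    · rfl
  · simp only [kraus]
    cases M.regType ω with
    | none => rfl
    | some h' =>
      cases q with
      | inl c => simp
      | inr h'' => by_cases hh : h'' = h' <;> simp [hh]

/-- The type of a state of the simulating automaton. -/
def simType : M.boundedFinset K ⊕ PostVerdict → PostVerdict := Sum.elim (fun _ => .nonpost) id

variable [DecidableEq M.Config]

/-- Outcomes are preserved until the end of the input. -/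
theorem heisenberg_kraus_inr (h h' : PostVerdict) (s : List (TapeSymbol α)) :
    heisenberg (M.kraus K) (Matrix.diagonal fun q => if simType q = h then 1 else 0) s
      (.inr h') (.inr h') = if h' = h then 1 else 0 := by
  induction s with
  | nil =>
    rw [heisenberg, Matrix.diagonal_apply_eq]
    rfl
  | cons σ s ih =>
    simp only [heisenberg, Matrix.sum_apply]
    rw [Fintype.sum_sum_type, Finset.sum_eq_zero, zero_add, Finset.sum_eq_single h']
    · simp only [kraus, Matrix.conjTranspose_single, star_one, Matrix.single_mul_mul_single, ih]
      simp
    · intro h'' _ hne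
      simp [kraus, Matrix.single_mul_mul_single, hne]
    · simp
    · intro i _
      rw [Matrix.mul_apply]
      exact Finset.sum_eq_zero fun q _ => by rw [kraus_inl_apply_inr, mul_zero]

/-- The operation elements `M.kraus K` simulate `M` as long as it stays in `[-K, K]`. -/
theorem quad_heisenberg_kraus {h : PostVerdict} (hh : h ≠ .nonpost) (s : List (TapeSymbol α))
    {ψ : M.Config →₀ ℝ} (hψ : M.IsBounded K ψ)
    (hvis : M.visitedFrom s ψ ⊆ Set.Icc (-K : ℤ) K) :
    M.coords K ψ ⬝ᵥ (heisenberg (M.kraus K)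
      (Matrix.diagonal fun q => if simType q = h then 1 else 0) s *ᵥ M.coords K ψ) =
        M.haltProb h s ψ := by
  induction s generalizing ψ with
  | nil =>
    simp [heisenberg, haltProb, dotProduct, Matrix.mulVec_diagonal, coords, simType, Ne.symm hh]
  | cons σ s ih =>
    rw [quad_heisenberg_cons, Fintype.sum_sum_type, Fintype.sum_prod_type, haltProb]
    simp only [kraus_inr_mulVec_coords, zero_dotProduct, Finset.sum_const_zero, add_zero]
    refine Finset.sum_congr rfl fun ω _ => ?_
    have hevo := hψ.evolve ((M.heads_evolve_subset σ ω s ψ).trans hvis)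
    rw [Fintype.sum_option, kraus_none_mulVec_coords hψ]
    cases hω : M.regType ω with
    | none =>
      have h0 : ∀ c, M.kraus K σ (.inl (ω, some c)) = 0 := fun c => by simp [kraus, hω]
      simp only [h0, Matrix.zero_mulVec, zero_dotProduct, Finset.sum_const_zero, add_zero,
        if_true]
      exact ih hevo ((M.visitedFrom_evolve_subset hω s ψ).trans hvis)
    | some h' =>
      simp only [kraus_some_mulVec_coords hψ σ _ hω, reduceCtorEq, if_false, zero_dotProduct,
        zero_add, Matrix.mulVec_smul, smul_dotProduct, dotProduct_smul, smul_eq_mul,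
        Matrix.mulVec_single_one, single_one_dotProduct, Matrix.col_apply,
        heisenberg_kraus_inr, normSq_of_isBounded hevo]
      split_ifs
      · exact Finset.sum_congr rfl fun c _ => by ring
      · simp

end RealTimeQTM

/-- Recognition with postselection depends only on the ratio of the probabilities of acceptance
and rejection. -/
theorem RecognizesPost.of_scale {α : Type} {p q : PostVerdict → List α → ℝ} {L : Language α}
    (h : RecognizesPost p L) (c : List α → ℝ) (hc : ∀ w, 0 < c w)
    (hq : ∀ v ≠ PostVerdict.nonpost, ∀ w, q v w = c w * p v w) : RecognizesPost q L := by
  have ha := hq .accept (by simp)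
  have hr := hq .reject (by simp)
  unfold RecognizesPost at h ⊢
  simp only [ha, hr, ← mul_add, mul_div_mul_left _ _ (hc _).ne']
  exact ⟨fun w => mul_pos (hc w) (h.1 w), h.2⟩

theorem postRtBQSPACE1_subset_postBQAL : PostRtBQSPACE1 ⊆ PostBQAL := by
  classical
  rintro L ⟨M, hM, hL⟩
  obtain ⟨K, hK⟩ := hM.constantSpace
  let start : M.boundedFinset K :=
    ⟨M.initConfig, by simpa [RealTimeQTM.boundedFinset] using M.initConfig_mem_boundedConfigs K⟩
  obtain ⟨N, c, hc, hN⟩ := exists_postQFA (M.kraus K) (.inl start) (.inr .nonpost)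
    RealTimeQTM.simType rfl (by
      rintro σ (i | h) q hq
      · exact RealTimeQTM.kraus_inl_apply_inr σ i q _
      · simp only [RealTimeQTM.kraus]
        rw [Matrix.single_apply, if_neg]
        rintro ⟨rfl, h⟩
        exact hq h)
  refine ⟨N, hL.of_scale (fun w => c (inputTape w)) (fun w => hc _) fun v hv w => ?_⟩
  rw [hN v hv]
  congr 1
  rw [RealTimeQTM.prob, ← RealTimeQTM.quad_heisenberg_kraus hv _
    (M.isBounded_single_initConfig K) (M.visited_subset_Icc (hK w))]
  have h1 : M.coords K (Finsupp.single M.initConfig 1) = Pi.single (.inl start) 1 := by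
    funext q
    cases q with
    | inl c =>
      by_cases h : c = start
      · subst h; simp [RealTimeQTM.coords, start]
      · have h' : c.1 ≠ M.initConfig := fun h' => h (Subtype.ext h')
        simp [RealTimeQTM.coords, h, Finsupp.single_eq_of_ne h']
    | inr h => simp [RealTimeQTM.coords]
  simp [h1]

/-! ### Rational numbers are efficiently computable -/

section ConstComputer

open Turing TM2.Stmt

variable {Γ₀ Γ₁ : Type}

/-- The stack alphabets of a machine with an input stack and a separate output stack. -/
abbrev IOStack (Γ₀ Γ₁ : Type) (k : Bool) : Type := bif k then Γ₁ else Γ₀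

/-- The stacks with content `x` of the input stack and `y` of the output stack. -/
def ioStacks (x : List Γ₀) (y : List Γ₁) : ∀ k, List (IOStack Γ₀ Γ₁ k)
  | false => x
  | true => y

/-- Push the elements of a list, the first one first, on the output stack and halt. -/
def pushAll : List Γ₁ → TM2.Stmt (IOStack Γ₀ Γ₁) Unit Bool
  | [] => halt
  | a :: l => push true (fun _ => a) (pushAll l)

theorem stepAux_pushAll (l : List Γ₁) (v : Bool) (x : List Γ₀) (y : List Γ₁) :
    TM2.stepAux (pushAll l) v (ioStacks x y) = ⟨none, v, ioStacks x (l.reverse ++ y)⟩ := by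
  induction l generalizing y with
  | nil => rfl
  | cons a l ih =>
    have h : Function.update (ioStacks x y) true (a :: y : List Γ₁) = ioStacks x (a :: y) := by
      funext k
      cases k <;> rfl
    change TM2.stepAux (pushAll l) v (Function.update (ioStacks x y) true (a :: y : List Γ₁)) = _
    rw [h, ih, List.reverse_cons, List.append_assoc]
    rfl

/-- A Turing machine that erases its input and then outputs the list `l`. -/
def constComputer (Γ₀ : Type) {Γ₁ : Type} [Fintype Γ₀] (l : List Γ₁) : FinTM2 where
  K := Bool
  k₀ := false
  k₁ := true
  Γ := IOStack Γ₀ Γ₁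
  Λ := Unit
  main := ()
  σ := Bool
  initialState := false
  Γk₀Fin := inferInstanceAs (Fintype Γ₀)
  m _ := pop false (fun _ o => o.isSome) (branch id (goto fun _ => ()) (pushAll l.reverse))

theorem initList_constComputer [Fintype Γ₀] (l : List Γ₁) (x : List Γ₀) :
    initList (constComputer Γ₀ l) x = ⟨some (), false, ioStacks x []⟩ := by
  unfold initList
  congr 1
  funext k
  cases k <;> rfl

theorem haltList_constComputer [Fintype Γ₀] (l y : List Γ₁) :
    haltList (constComputer Γ₀ l) y = ⟨none, false, ioStacks [] y⟩ := by
  unfold haltList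
  congr 1
  funext k
  cases k <;> rfl

theorem constComputer_step_cons [Fintype Γ₀] (l : List Γ₁) (a : Γ₀) (x : List Γ₀) (v : Bool) :
    (constComputer Γ₀ l).step ⟨some (), v, ioStacks (a :: x) []⟩ =
      some ⟨some (), true, ioStacks x []⟩ := by
  have h : Function.update (ioStacks (a :: x) ([] : List Γ₁)) false (x : List Γ₀) =
      ioStacks x [] := by
    funext k
    cases k <;> rfl
  rw [← h]
  rfl

theorem constComputer_step_nil [Fintype Γ₀] (l : List Γ₁) (v : Bool) :
    (constComputer Γ₀ l).step ⟨some (), v, ioStacks [] []⟩ =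
      some ⟨none, false, ioStacks [] l⟩ := by
  have h : Function.update (ioStacks ([] : List Γ₀) ([] : List Γ₁)) false ([] : List Γ₀) =
      ioStacks [] [] := by
    funext k
    cases k <;> rfl
  change some (TM2.stepAux (pushAll l.reverse) false
    (Function.update (ioStacks ([] : List Γ₀) ([] : List Γ₁)) false ([] : List Γ₀))) = _
  rw [h, stepAux_pushAll, List.reverse_reverse, List.append_nil]
  rfl

theorem constComputer_iterate [Fintype Γ₀] (l : List Γ₁) (x : List Γ₀) (v : Bool) :
    (flip bind (constComputer Γ₀ l).step)^[x.length + 1]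
        (some (⟨some (), v, ioStacks x []⟩ : (constComputer Γ₀ l).Cfg)) =
      some ⟨none, false, ioStacks [] l⟩ := by
  induction x generalizing v with
  | nil => exact constComputer_step_nil l v
  | cons a x ih =>
    rw [List.length_cons, Function.iterate_succ_apply, ← ih true]
    congr 1
    exact constComputer_step_cons l a x v

/-- Constant functions are computable in polynomial time. -/
noncomputable def constComputableInPolyTime {α β αΓ βΓ : Type} [Fintype αΓ] (ea : α → List αΓ)
    (eb : β → List βΓ) (b : β) : TM2ComputableInPolyTime ea eb fun _ => b where
  tm := constComputer αΓ (eb b)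
  inputAlphabet := Equiv.refl αΓ
  outputAlphabet := Equiv.refl βΓ
  time := Polynomial.X + 1
  outputsFun a :=
    { steps := (ea a).length + 1
      evals_in_steps := by
        have h0 : List.map (Equiv.refl αΓ).invFun (ea a) = ea a := List.map_id _
        have h1 : List.map (Equiv.refl βΓ).invFun (eb b) = eb b := List.map_id _
        refine Eq.trans ?_ ((constComputer_iterate (eb b) (ea a) false).trans ?_)
        · exact congrArg (fun c => (flip bind (constComputer αΓ (eb b)).step)^[_] (some c))
            ((congrArg (initList (constComputer αΓ (eb b))) h0).trans (initList_constComputer _ _))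
        · exact congrArg some
            ((congrArg (haltList (constComputer αΓ (eb b))) h1).trans
              (haltList_constComputer _ _)).symm
      steps_le_m := by simp }

end ConstComputer

theorem efficientlyComputable_ratCast (q : ℚ) : EfficientlyComputable (q : ℝ) :=
  ⟨fun _ => q, ⟨constComputableInPolyTime _ _ q⟩, fun n => by simp⟩

/-! ### The palindromes are not regular -/

theorem palindromes_not_mem_REG : palindromes ∉ REG := by
  intro h
  have hfin : (Set.range palindromes.lang.leftQuotient).Finite :=
    Language.IsRegular.finite_range_leftQuotient h
  -- The words `f n` have pairwise different left quotients.
  let f (n : ℕ) : List Bool := List.replicate n true ++ [false]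
  have hmem : ∀ n m, f n ++ List.replicate m true ∈ palindromes.lang ↔ n = m := by
    intro n m
    change f n ++ List.replicate m true = (f n ++ List.replicate m true).reverse ↔ _
    constructor
    · intro h
      simp only [f, List.append_assoc, List.reverse_append, List.reverse_replicate,
        List.reverse_singleton] at h
      have := congrArg (List.idxOf false) h
      simpa [List.idxOf_append] using this
    · rintro rfl
      simp [f]
  have hinj : Function.Injective fun n => palindromes.lang.leftQuotient (f n) := by
    intro n m hnm
    have h1 : List.replicate n true ∈ palindromes.lang.leftQuotient (f n) := (hmem n n).2 rfl
    rw [show palindromes.lang.leftQuotient (f n) = palindromes.lang.leftQuotient (f m) from hnm]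
      at h1
    exact ((hmem m n).1 h1).symm
  exact Set.infinite_range_of_injective hinj
    (hfin.subset (Set.range_comp_subset_range f palindromes.lang.leftQuotient))

/-! ### A machine for the palindromes -/

/-- The update of the integer vector `(1, 2 ^ i, x, y)`, where `i` is the number of letters read,
and `x` and `y` are the numbers with the word read as binary expansion, with the most and the least
significant digit first. -/
def palStep : TapeSymbol Bool → Matrix (Fin 4) (Fin 4) ℤ
  | .leftEnd => !![1, 0, 0, 0; 1, 0, 0, 0; 0, 0, 0, 0; 0, 0, 0, 0]
  | .letter false => !![1, 0, 0, 0; 0, 2, 0, 0; 0, 0, 2, 0; 0, 0, 0, 1]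
  | .letter true => !![1, 0, 0, 0; 0, 2, 0, 0; 1, 0, 2, 0; 0, 1, 0, 1]
  | .rightEnd => 0

/-- At the right end-marker, the amplitude of acceptance is `1` and that of rejection is
`2 * (x - y)`, up to a common factor. -/
def palOut : PostVerdict → TapeSymbol Bool → Fin 4 → ℤ
  | .accept, .rightEnd => ![1, 0, 0, 0]
  | .reject, .rightEnd => ![0, 0, 2, -2]
  | _, _ => 0

/-- The operations that complete `palStep` and `palOut` to a multiple of an isometry. -/
def palWaste : TapeSymbol Bool → Matrix (Fin 8) (Fin 4) ℤ
  | .leftEnd => !![3, 0, 0, 0; 2, 0, 0, 0; 1, 0, 0, 0; 0, 4, 0, 0;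
      0, 0, 4, 0; 0, 0, 0, 4; 0, 0, 0, 0; 0, 0, 0, 0]
  | .letter false => !![3, 0, 0, -2; 2, 0, 0, 3; 1, 0, 0, -1; 1, 0, 0, 1;
      0, 2, 2, 0; 0, 2, -2, 0; 0, 2, 0, 0; 0, 0, 2, 0]
  | .letter true => !![3, 0, -1, 0; 2, 0, 1, 0; 1, 0, -1, 0; 0, 0, 3, 0;
      0, 3, 0, -1; 0, 1, 0, 3; 0, 1, 0, -1; 0, 0, 0, 2]
  | .rightEnd => !![3, 0, 0, 0; 2, 0, 0, 0; 1, 0, 0, 0; 1, 0, 0, 0;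
      0, 0, 2, 2; 0, 0, 2, 2; 0, 0, 2, -2; 0, 4, 0, 0]

/-- Four times the amplitudes of the machine for the palindromes. The states are the coordinates
of the vector and the outcomes; the register symbols are the continuing one, one for each outcome,
and one for each row of `palWaste`, which leads to nonpostselection. Halted computations are idle.
-/
def palAmp (σ : TapeSymbol Bool) :
    Option PostVerdict ⊕ Fin 8 → Fin 4 ⊕ PostVerdict → Fin 4 ⊕ PostVerdict → ℤ
  | .inl none, .inl j, .inl i => palStep σ i j
  | .inl (some h), .inl j, .inr h' => if h' = h then palOut h σ j else 0
  | .inl (some .nonpost), .inr h, .inr h' => if h' = h then 4 else 0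
  | .inr k, .inl j, .inr .nonpost => palWaste σ k j
  | _, _, _ => 0

/-- With amplitudes `palAmp / 4` the completeness relation holds on all states. -/
theorem sum_palAmp_mul (σ : TapeSymbol Bool) (q q' : Fin 4 ⊕ PostVerdict) :
    ∑ ω, ∑ p, palAmp σ ω q p * palAmp σ ω q' p = if q = q' then 16 else 0 := by
  rcases σ with _ | (_ | _) | _ <;> revert q q' <;> decide +kernel

/-- The machine for the palindromes. It does not use its work tape. -/
noncomputable abbrev palQTM : RealTimeQTM Bool PostVerdict where
  State := Fin 4 ⊕ PostVerdict
  Work := Unit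
  Reg := Option PostVerdict ⊕ Fin 8
  stateFintype := inferInstance
  workFintype := inferInstance
  regFintype := inferInstance
  blank := ()
  start := .inl 0
  regStart := .inl none
  stateType := Sum.elim (fun _ => none) some
  regType := Sum.elim id fun _ => some .nonpost
  δ q σ _ q' _ d ω := if d = .stationary then ((palAmp σ ω q q' / 4 : ℚ) : ℝ) else 0
  stateType_start := rfl
  regType_regStart := rfl
  stateType_eq q σ _ q' _ d ω hq hδ := by
    have h : palAmp σ ω q q' ≠ 0 := by
      intro h
      simp [h] at hδ
    rcases q with j | h'
    · rcases ω with (_ | h₁) | k <;> rcases q' with i | h₂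
      · rfl
      · exact absurd rfl h
      · exact absurd rfl h
      · by_cases hh : h₂ = h₁
        · simp [hh]
        · simp [palAmp, hh] at h
      · exact absurd rfl h
      · cases h₂
        · exact absurd rfl h
        · exact absurd rfl h
        · rfl
    · simp at hq

namespace palQTM

/-- The configuration with state `q`. -/
def config (q : Fin 4 ⊕ PostVerdict) : palQTM.Config := ⟨q, 0, fun _ => ()⟩

theorem config_injective : Function.Injective config := fun _ _ h => congrArg (·.state) h

theorem column_config (σ : TapeSymbol Bool) (ω : Option PostVerdict ⊕ Fin 8)
    (q : Fin 4 ⊕ PostVerdict) : palQTM.column σ ω (config q) =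
      ∑ q', Finsupp.single (config q') ((palAmp σ ω q q' : ℝ) / 4) := by
  unfold RealTimeQTM.column
  refine Finset.sum_congr rfl fun (q' : Fin 4 ⊕ PostVerdict) _ => ?_
  have h : palQTM.next (config q) q' () .stationary = config q' := rfl
  rw [show (Finset.univ : Finset palQTM.Work) = {()} from rfl, Finset.sum_singleton,
    Finset.sum_eq_single Move.stationary]
  · rw [h]
    simp [palQTM]
    rfl
  · intro d _ hd
    simp [palQTM, hd]
  · simp

theorem eq_config_of_reachable {w : List Bool} {t : ℕ} {c : palQTM.Config}
    (hc : palQTM.Reachable w t c) : c = config c.state := by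
  induction hc with
  | init => rfl
  | step ω _ hσ hcol ih =>
    rw [ih, column_config, Finsupp.finsetSum_apply] at hcol
    obtain ⟨q', -, hq'⟩ := Finset.exists_ne_zero_of_sum_ne_zero hcol
    have := (Finsupp.single_apply_ne_zero.1 hq').1
    rw [this]
    rfl

theorem dot_column_config (σ : TapeSymbol Bool) (ω : Option PostVerdict ⊕ Fin 8)
    (q q' : Fin 4 ⊕ PostVerdict) :
    dot (palQTM.column σ ω (config q)) (palQTM.column σ ω (config q')) =
      ((∑ p, palAmp σ ω q p * palAmp σ ω q' p : ℤ) : ℝ) / 16 := by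
  classical
  simp only [column_config, map_sum, LinearMap.sum_apply, dot_single_single,
    config_injective.eq_iff]
  simp only [Finset.sum_ite_eq', Finset.mem_univ, if_true]
  push_cast
  rw [Finset.sum_div]
  exact Finset.sum_congr rfl fun p _ => by ring

theorem wellFormed : palQTM.WellFormed := by
  classical
  intro w t σ _ c c' hc hc'
  rw [eq_config_of_reachable hc, eq_config_of_reachable hc',
    if_congr config_injective.eq_iff rfl rfl]
  have h : ∀ ω : palQTM.Reg, (palQTM.column σ ω (config c.state)).sum
      (fun x a => a * palQTM.column σ ω (config c'.state) x) =
        ((∑ p, palAmp σ ω c.state p * palAmp σ ω c'.state p : ℤ) : ℝ) / 16 := fun ω => by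
    rw [← dot_apply, dot_column_config]
  simp only [h]
  rw [← Finset.sum_div, ← Int.cast_sum]
  have := sum_palAmp_mul σ c.state c'.state
  refine (congrArg (fun z : ℤ => (z : ℝ) / 16) this).trans ?_
  split_ifs <;> norm_num

theorem heads_evolve_subset (σ : TapeSymbol Bool) (ω : palQTM.Reg) (ψ : palQTM.Config →₀ ℝ) :
    RealTimeQTM.heads (palQTM.evolve σ ω ψ) ⊆ RealTimeQTM.heads ψ := by
  rintro z ⟨c', hc', rfl⟩
  obtain ⟨c, hc, hcol⟩ := palQTM.exists_of_evolve_ne_zero hc'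
  obtain ⟨q', γ', d, hδ, rfl⟩ := palQTM.exists_of_column_ne_zero hcol
  have hd : d = .stationary := by
    by_contra hd
    exact hδ (if_neg hd)
  subst hd
  exact ⟨c, hc, (add_zero c.head).symm⟩

theorem isConstantSpaceQTM : IsConstantSpaceQTM palQTM where
  wellFormed := wellFormed
  constantSpace := by
    refine ⟨1, fun w => (Set.encard_le_encard (t := {0}) ?_).trans (by simp)⟩
    refine (palQTM.visitedFrom_subset_heads heads_evolve_subset _ _).trans ?_
    rintro z ⟨c, hc, rfl⟩
    by_cases h : c = palQTM.initConfig
    · rw [h]; rfl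
    · exact absurd (Finsupp.single_eq_of_ne h) hc
  efficientAmplitudes := by
    intro q σ γ q' γ' d ω
    change EfficientlyComputable (if d = .stationary then ((palAmp σ ω q q' / 4 : ℚ) : ℝ) else 0)
    split_ifs
    · exact efficientlyComputable_ratCast _
    · simpa using efficientlyComputable_ratCast 0

/-- The superposition of continuing configurations with amplitudes `v`. -/
noncomputable def superposition (v : Fin 4 → ℝ) : palQTM.Config →₀ ℝ :=
  ∑ i, Finsupp.single (config (.inl i)) (v i)

theorem evolve_superposition (σ : TapeSymbol Bool) (ω : Option PostVerdict ⊕ Fin 8)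
    (v : Fin 4 → ℝ) : palQTM.evolve σ ω (superposition v) =
      ∑ q', Finsupp.single (config q') (∑ j, (palAmp σ ω (.inl j) q' : ℝ) / 4 * v j) := by
  rw [superposition, RealTimeQTM.evolve_eq, map_sum]
  simp only [Finsupp.linearCombination_single, column_config, Finset.smul_sum,
    Finsupp.smul_single, smul_eq_mul]
  rw [Finset.sum_comm]
  refine Finset.sum_congr rfl fun q' _ => ?_
  rw [Finsupp.single_finsetSum]
  exact Finset.sum_congr rfl fun j _ => by rw [mul_comm]

theorem evolve_continue (σ : TapeSymbol Bool) (r : ℝ) (u : Fin 4 → ℤ) :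
    palQTM.evolve σ (Sum.inl none : Option PostVerdict ⊕ Fin 8)
        (superposition fun i => r * (u i : ℝ)) =
      superposition fun i => r / 4 * ((palStep σ *ᵥ u) i : ℤ) := by
  rw [evolve_superposition, Fintype.sum_sum_type, superposition]
  simp only [palAmp, Int.cast_zero, zero_div, zero_mul, Finset.sum_const_zero,
    Finsupp.single_zero, add_zero]
  refine Finset.sum_congr rfl fun i _ => congrArg _ ?_
  simp only [Matrix.mulVec, dotProduct, Int.cast_sum, Int.cast_mul, Finset.mul_sum]
  exact Finset.sum_congr rfl fun j _ => by ring

theorem normSq_evolve_outcome (σ : TapeSymbol Bool) (h : PostVerdict) (r : ℝ) (u : Fin 4 → ℤ) :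
    RealTimeQTM.normSq (palQTM.evolve σ (Sum.inl (some h) : Option PostVerdict ⊕ Fin 8)
        (superposition fun i => r * (u i : ℝ))) =
      r ^ 2 / 16 * ((palOut h σ ⬝ᵥ u : ℤ) : ℝ) ^ 2 := by
  rw [evolve_superposition, Fintype.sum_sum_type, Finset.sum_eq_zero, zero_add,
    Finset.sum_eq_single h, RealTimeQTM.normSq_single]
  · have : ∑ j, (palAmp σ (.inl (some h)) (.inl j) (.inr h) : ℝ) / 4 * (r * (u j : ℝ)) =
        r / 4 * ((palOut h σ ⬝ᵥ u : ℤ) : ℝ) := by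
      simp only [palAmp, if_true, dotProduct, Int.cast_sum, Int.cast_mul, Finset.mul_sum]
      exact Finset.sum_congr rfl fun j _ => by ring
    rw [this]
    ring
  · intro h' _ hne
    simp [palAmp, hne]
  · simp
  · intro i _
    simp [palAmp]

theorem haltProb_cons {h : PostVerdict} (hh : h ≠ .nonpost) (σ : TapeSymbol Bool)
    (s : List (TapeSymbol Bool)) (r : ℝ) (u : Fin 4 → ℤ) :
    palQTM.haltProb h (σ :: s) (superposition fun i => r * (u i : ℝ)) =
      palQTM.haltProb h s (superposition fun i => r / 4 * ((palStep σ *ᵥ u) i : ℤ)) +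
        r ^ 2 / 16 * ((palOut h σ ⬝ᵥ u : ℤ) : ℝ) ^ 2 := by
  rw [RealTimeQTM.haltProb]
  refine (Fintype.sum_sum_type (α₁ := Option PostVerdict) (α₂ := Fin 8) _).trans ?_
  rw [Fintype.sum_option]
  simp only [Sum.elim_inl, Sum.elim_inr, id, if_neg (Ne.symm hh), Finset.sum_const_zero, add_zero,
    Finset.sum_ite_eq', Finset.mem_univ, if_true]
  rw [evolve_continue, normSq_evolve_outcome]

/-- The integer vector after reading a word, starting from `u`. -/
def run (w : List Bool) (u : Fin 4 → ℤ) : Fin 4 → ℤ :=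
  w.foldl (fun u b => palStep (.letter b) *ᵥ u) u

/-- Every step contributes the factor `1 / 4` to the amplitudes. -/
theorem haltProb_letters {h : PostVerdict} (hh : h ≠ .nonpost) (w : List Bool) (r : ℝ)
    (u : Fin 4 → ℤ) :
    palQTM.haltProb h (w.map TapeSymbol.letter ++ [TapeSymbol.rightEnd])
        (superposition fun i => r * (u i : ℝ)) =
      r ^ 2 * (1 / 16) ^ (w.length + 1) *
        ((palOut h TapeSymbol.rightEnd ⬝ᵥ run w u : ℤ) : ℝ) ^ 2 := by
  induction w generalizing r u with
  | nil =>
    rw [List.map_nil, List.nil_append, haltProb_cons hh, RealTimeQTM.haltProb]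
    simp only [run, List.foldl_nil, List.length_nil, zero_add, pow_one]
    ring
  | cons b w ih =>
    have h0 : palOut h (TapeSymbol.letter b) = 0 := by cases h <;> rfl
    rw [List.map_cons, List.cons_append, haltProb_cons hh, ih, h0]
    simp only [run, List.foldl_cons, List.length_cons, zero_dotProduct]
    push_cast
    ring

theorem prob_eq {h : PostVerdict} (hh : h ≠ .nonpost) (w : List Bool) :
    palQTM.prob h w = (1 / 16) ^ (w.length + 2) *
      ((palOut h TapeSymbol.rightEnd ⬝ᵥ run w ![1, 1, 0, 0] : ℤ) : ℝ) ^ 2 := by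
  have hinit : Finsupp.single palQTM.initConfig 1 =
      superposition fun i => 1 * ((![1, 0, 0, 0] i : ℤ) : ℝ) := by
    simp [superposition, Fin.sum_univ_succ]
    rfl
  have h0 : palOut h TapeSymbol.leftEnd = 0 := by cases h <;> rfl
  have h1 : palStep .leftEnd *ᵥ ![1, 0, 0, 0] = ![1, 1, 0, 0] := by decide
  rw [RealTimeQTM.prob, inputTape, hinit, haltProb_cons hh, haltProb_letters hh, h0, h1]
  simp only [zero_dotProduct]
  push_cast
  ring

/-- The number with a given binary expansion, least significant digit first. -/
def value (w : List Bool) : ℕ := Nat.ofDigits 2 (w.map Bool.toNat)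

theorem value_cons (b : Bool) (w : List Bool) : value (b :: w) = b.toNat + 2 * value w := by
  simp [value, Nat.ofDigits_cons]

theorem value_append_singleton (w : List Bool) (b : Bool) :
    value (w ++ [b]) = value w + 2 ^ w.length * b.toNat := by
  simp [value, Nat.ofDigits_append]

theorem value_injOn {w w' : List Bool} (hl : w.length = w'.length) (h : value w = value w') :
    w = w' := by
  have hinj : Function.Injective Bool.toNat := by decide
  refine List.map_injective_iff.2 hinj (Nat.ofDigits_inj_of_len_eq one_lt_two (by simpa) ?_ ?_ h)
  all_goals
    intro d hd
    obtain ⟨b, -, rfl⟩ := List.mem_map.1 hd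
    cases b <;> simp

theorem run_eq (w : List Bool) (z x y : ℤ) : run w ![1, z, x, y] =
    ![1, 2 ^ w.length * z, 2 ^ w.length * x + value w.reverse, y + z * value w] := by
  induction w generalizing z x y with
  | nil => simp [run, value]
  | cons b w ih =>
    have h : palStep (.letter b) *ᵥ ![1, z, x, y] =
        ![1, 2 * z, 2 * x + b.toNat, y + b.toNat * z] := by
      cases b <;> funext i <;> fin_cases i <;>
        simp [palStep, Matrix.mulVec, dotProduct, Fin.sum_univ_succ] <;> ring
    have h' : run (b :: w) ![1, z, x, y] = run w (palStep (.letter b) *ᵥ ![1, z, x, y]) := rfl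
    rw [h', h, ih, List.reverse_cons, value_append_singleton, value_cons, List.length_cons,
      List.length_reverse]
    push_cast
    congr 2 <;> [skip; congr 1 <;> [skip; congr 1]] <;> ring_nf

theorem prob_accept (w : List Bool) : palQTM.prob .accept w = (1 / 16) ^ (w.length + 2) := by
  rw [prob_eq (by simp), run_eq]
  simp [palOut, dotProduct, Fin.sum_univ_succ]

theorem prob_reject (w : List Bool) : palQTM.prob .reject w = (1 / 16) ^ (w.length + 2) *
    (4 * (((value w.reverse : ℤ) - value w : ℤ) : ℝ) ^ 2) := by
  rw [prob_eq (by simp), run_eq]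
  simp [palOut, dotProduct, Fin.sum_univ_succ]
  ring

theorem recognizesPost :
    RecognizesPost (fun h w => palQTM.prob h w) {w : List Bool | w = w.reverse} := by
  have hpos : ∀ w : List Bool, (0 : ℝ) < (1 / 16) ^ (w.length + 2) := fun w => by positivity
  refine ⟨fun w => ?_, 1 / 5, by norm_num, by norm_num, fun w hw => ?_, fun w hw => ?_⟩
  · have := palQTM.haltProb_nonneg .reject (inputTape w) (Finsupp.single palQTM.initConfig 1)
    change 0 < palQTM.prob .accept w + palQTM.prob .reject w
    rw [prob_accept]
    exact add_pos_of_pos_of_nonneg (hpos w) this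
  · have hw' : w.reverse = w := hw.symm
    simp only [prob_accept, prob_reject, hw', sub_self, Int.cast_zero]
    rw [zero_pow two_ne_zero, mul_zero, mul_zero, add_zero, div_self (hpos w).ne']
    norm_num
  · have hne : (value w.reverse : ℤ) - value w ≠ 0 := by
      intro h
      have h' : value w = value w.reverse := by omega
      exact hw (value_injOn (by simp) h')
    -- Distinct integers differ by at least one.
    have h1 : (1 : ℝ) ≤ (((value w.reverse : ℤ) - value w : ℤ) : ℝ) ^ 2 := by
      have : (0 : ℤ) < ((value w.reverse : ℤ) - value w) ^ 2 := by positivity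
      exact_mod_cast this
    simp only [prob_accept, prob_reject]
    set t : ℝ := (((value w.reverse : ℤ) - value w : ℤ) : ℝ) ^ 2
    have h2 : ((1 : ℝ) / 16) ^ (w.length + 2) + (1 / 16) ^ (w.length + 2) * (4 * t) =
        (1 / 16) ^ (w.length + 2) * (1 + 4 * t) := by ring
    rw [h2, mul_div_mul_left _ _ (hpos w).ne', le_div_iff₀ (by positivity)]
    linarith

/-- All computations halt at the right end-marker. -/
theorem contSum_eq_zero (s : List (TapeSymbol Bool)) (ψ : palQTM.Config →₀ ℝ) :
    palQTM.contSum RealTimeQTM.normSq (s ++ [TapeSymbol.rightEnd]) ψ = 0 := by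
  induction s generalizing ψ with
  | nil =>
    refine Finset.sum_eq_zero fun (ω : Option PostVerdict ⊕ Fin 8) _ => ?_
    rcases ω with (_ | h) | k
    · have hcol : ∀ c, palQTM.column .rightEnd
          (Sum.inl none : Option PostVerdict ⊕ Fin 8) c = 0 := by
        intro c
        unfold RealTimeQTM.column
        refine Finset.sum_eq_zero fun q' _ => Finset.sum_eq_zero fun γ' _ =>
          Finset.sum_eq_zero fun d _ => ?_
        have h0 : palAmp .rightEnd (.inl none) c.state q' = 0 := by
          generalize c.state = q
          rcases q with j | h <;> rcases q' with i | h' <;> rfl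
        have hδ : palQTM.δ c.state .rightEnd (c.tape c.head) q' γ' d
            (Sum.inl none : Option PostVerdict ⊕ Fin 8) = 0 := by
          simp [palQTM, h0]
        exact (congrArg _ hδ).trans (Finsupp.single_zero _)
      have : palQTM.evolve .rightEnd (Sum.inl none : Option PostVerdict ⊕ Fin 8) ψ = 0 := by
        simp [RealTimeQTM.evolve, hcol]
      change RealTimeQTM.normSq _ = 0
      rw [this, RealTimeQTM.normSq_zero]
    · rfl
    · rfl
  | cons σ s ih =>
    refine Finset.sum_eq_zero fun ω _ => ?_
    cases palQTM.regType ω with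
    | none => exact ih _
    | some h => rfl

theorem sum_prob (w : List Bool) : ∑ h, palQTM.prob h w = 1 := by
  have h1 := wellFormed.sum_prob_add w
  have h2 := contSum_eq_zero (.leftEnd :: w.map .letter) (Finsupp.single palQTM.initConfig 1)
  rw [List.cons_append] at h2
  rwa [inputTape, h2, add_zero] at h1

end palQTM

theorem palindromes_mem_postRtBQSPACE1 : palindromes ∈ PostRtBQSPACE1 :=
  ⟨palQTM, palQTM.isConstantSpaceQTM, palQTM.recognizesPost⟩

theorem palindromes_mem_restartRtBQSPACE1 : palindromes ∈ RestartRtBQSPACE1 :=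
  ⟨palQTM.relabel PostVerdict.toRestart,
    palQTM.isConstantSpaceQTM_relabel _ palQTM.isConstantSpaceQTM,
    palQTM.recognizesPost.recognizesRestart (fun v _ => palQTM.haltProb_nonneg v _ _)
      palQTM.sum_prob fun v _ => palQTM.prob_relabel _ PostVerdict.toRestart_injective v _⟩

end Postselection

open Postselection in
theorem mainTheorem4 :
    rtBQSPACE1 ⊂ PostRtBQSPACE1 ∧ PostRtBQSPACE1 ⊆ PostBQAL ∧
    palindromes ∈ PostRtBQSPACE1 ∧ palindromes ∉ rtBQSPACE1 ∧
    palindromes ∈ RestartRtBQSPACE1 ∧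
    rtBQSPACE1 ⊆ REG ∧ BQAL ⊆ REG := by
  have hpal : palindromes ∉ rtBQSPACE1 := fun h =>
    palindromes_not_mem_REG (rtBQSPACE1_subset_REG h)
  exact ⟨⟨rtBQSPACE1_subset_postRtBQSPACE1, fun h => hpal (h palindromes_mem_postRtBQSPACE1)⟩,
    postRtBQSPACE1_subset_postBQAL, palindromes_mem_postRtBQSPACE1, hpal,
    palindromes_mem_restartRtBQSPACE1, rtBQSPACE1_subset_REG, BQAL_subset_REG⟩
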